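/- Let $n\ge 2$, $\gamma\in\mathbb C\setminus\{0\}$, let $e_{ij}$ be the matrix units of $\mathrm{End}(\mathbb C^n)$, and for $\lambda\in\mathbb C^n$ put $\lambda_{ij}=\lambda_i-\lambda_j$. Let $$d_{12}=\sum_{i,j}e_{ij}\otimes e_{ji},\qquad b_{12}=\sum_{i,j}e_{ii}\otimes e_{ji},$$ $$A^\infty_{12}=1+\sum_{i\ne j}\tfrac{\gamma}{\lambda_{ij}}(e_{ii}-e_{ij})\otimes(e_{jj}-e_{ji}),\qquad B^\infty_{12}=1+\sum_{i\ne j}\tfrac{\gamma}{\lambda_{ij}-\gamma}\,e_{jj}\otimes(e_{ii}-e_{ij}),$$ $$D^\infty_{12}=1+\sum_{i\ne j}\tfrac{\gamma}{\lambda_{ij}}(e_{ij}\otimes e_{ji}-e_{ii}\otimes e_{jj}),$$ and let the rational non-constant Arutyunov–Chekhov–Frolov (ACF) structure matrices be $$A_{12}(u,v)=A^\infty_{12}+\tfrac{\gamma}{u-v}d_{12}+\tfrac{\gamma}{v}b_{12}-\tfrac{\gamma}{u+\gamma}b_{21},\qquad B_{12}(v)=B^\infty_{12}-\tfrac{\gamma}{v+\gamma}b_{12},$$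 $$C_{12}(u)=B_{21}(u),\qquad D_{12}(u-v)=D^\infty_{12}+\tfrac{\gamma}{u-v}d_{12}.$$ Let $U\subseteq\mathbb C^n$ be a nonempty set which is stable under $\lambda_j\mapsto\lambda_j\pm\gamma$ for every $j$ and all of whose points have pairwise distinct coordinates. A matrix function $K(u;\lambda)$ is called a solution of the semi-dynamical reflection equation (SDRE) on $U$ if, for all $\lambda\in U$ and all $u,v\in\mathbb C\setminus\{0,-\gamma\}$ with $u\neq v$, $$A_{12}(u,v;\lambda)K_1(u;\lambda)B_{12}(v;\lambda)K_2(v;\lambda+\gamma h_1)=K_2(v;\lambda)C_{12}(u;\lambda)K_1(u;\lambda+\gamma h_2)D_{12}(u-v;\lambda),$$ where $K_1=K\otimes 1$, $K_2=1\otimes K$, $K_2(\lambda+\gamma h_1)=\sum_j e_{jj}\otimes K(\lambda+\gamma\epsilon_j)$, $K_1(\lambda+\gamma h_2)=\sum_j K(\lambda+\gamma\epsilon_j)\otimes e_{jj}$, and $\epsilon_j$ is the $j$-th standard basis vector of $\mathbb C^n$. A first-order extension of a matrix function $k^{(0)}(\lambda)$ is a solution of the form $K(u;\lambda)=k^{(0)}(\lambda)+\frac{\gamma}{u}k^{(1)}(\lambda)$.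 For a function $f$ on $U$ put $P_j=\prod_{a\ne j}\frac{\gamma}{\lambda_{ja}}$, $\Lambda_i=\sum_a\lambda_a-\lambda_i$, $\Lambda_{ij}=\sum_a\lambda_a-\lambda_i-\lambda_j$, and consider the four constant families $$\text{(Ia) } k^{(0)}_{ij}=\frac{f+\lambda_i}{f+\lambda_j}P_j,\qquad \text{(IIa) } k^{(0)}_{ij}=(f-\Lambda_{ij})P_j,$$ $$\text{(Ib) } k^{(0)}_{ij}=\frac{f+\Lambda_j}{f+\Lambda_i}P_j,\qquad \text{(IIb) } k^{(0)}_{ij}=\frac{f}{f-\lambda_{ij}}\prod_{a\neq j}\Bigl(1+\frac{f}{\lambda_{ja}}\Bigr).$$ Assume that the quantities $f+\lambda_i$ (for Ia), $f-\Lambda_{ij}$ (for IIa), $f+\Lambda_i$ (for Ib), respectively $f-\lambda_{ij}$ (for IIb), with all $i,j$ including $i=j$, vanish nowhere on $U$, so that $k^{(0)}$ is well defined and has no zero entry. 1. Let $f$ be $\gamma$-periodic on $U$ in each variable $\lambda_j$. If $n\ge 3$, families Ia and IIa have no first-order extension. Families Ib and IIb each have exactly one first-order extension; its $k^{(1)}$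 has no zero entry, and it is respectively $$\text{(Ib) } K_{ij}(u;\lambda)=(f+\Lambda_j)\Bigl(\frac1{f+\Lambda_i}-\frac1u\Bigr)P_j,\qquad \text{(IIb) } K_{ij}(u;\lambda)=f\Bigl(\frac1{f-\lambda_{ij}}-\frac1u\Bigr)\prod_{a\neq j}\Bigl(1+\frac{f}{\lambda_{ja}}\Bigr).$$ 2. Let $S\subsetneq\{1,\dots,n\}$. If $k^{(0)}$ is any matrix function whose columns with index in $S$ are zero on $U$ and whose other entries vanish nowhere on $U$, then for every first-order extension of $k^{(0)}$ the columns of $k^{(1)}$ with index in $S$ are zero on $U$. Moreover, let $f$ be $\gamma$-periodic on $U$ in each $\lambda_j$ with $j\notin S$. Then the assertions in 1 remain true when the columns with index in $S$ are set to zero in $k^{(0)}$ and in $K$ (the entries of $k^{(1)}$ outside these columns being nonzero for Ib and IIb). 3. For every function $f'$ on $U$ that is $\gamma$-periodic in each $\lambda_j$, the matrix $K(u;\lambda)=\bigl(1+\frac{f'(\lambda)}{u}\bigr)\mathbf 1$ is a solution of the SDRE on $U$. -/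

import Mathlib

open scoped Kronecker

noncomputable section

namespace ACF

variable {n : ℕ}

/-- `n × n` complex matrices. -/
abbrev Mat (n : ℕ) := Matrix (Fin n) (Fin n) ℂ

/-- Operators on `ℂⁿ ⊗ ℂⁿ`. -/
abbrev Mat2 (n : ℕ) := Matrix (Fin n × Fin n) (Fin n × Fin n) ℂ

/-- The matrix unit `e_{ij}`. -/
def e (i j : Fin n) : Mat n := Matrix.single i j 1

/-- Exchange of the two tensor factors, `M₁₂ ↦ M₂₁`. -/
def flip (M : Mat2 n) : Mat2 n := M.submatrix Prod.swap Prod.swap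

/-- `λ + γ e_j`: the `j`-th dynamical variable is shifted by `γ`. -/
def shift (γ : ℂ) (j : Fin n) (lam : Fin n → ℂ) : Fin n → ℂ :=
  lam + Pi.single j γ

def x (γ : ℂ) (lam : Fin n → ℂ) (i j : Fin n) : ℂ := γ / (lam i - lam j)

def y (γ : ℂ) (lam : Fin n → ℂ) (i j : Fin n) : ℂ := γ / (lam i - lam j - γ)

/-- `d₁₂ = ∑ e_{ij} ⊗ e_{ji}`. -/
def d : Mat2 n := ∑ i : Fin n, ∑ j : Fin n, e i j ⊗ₖ e j i

/-- `b₁₂ = ∑ e_{ii} ⊗ e_{ji}`. -/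
def b : Mat2 n := ∑ i : Fin n, ∑ j : Fin n, e i i ⊗ₖ e j i

def AInf (γ : ℂ) (lam : Fin n → ℂ) : Mat2 n :=
  1 + ∑ i : Fin n, ∑ j : Fin n,
    if i ≠ j then x γ lam i j • ((e i i - e i j) ⊗ₖ (e j j - e j i)) else 0

def BInf (γ : ℂ) (lam : Fin n → ℂ) : Mat2 n :=
  1 + ∑ i : Fin n, ∑ j : Fin n,
    if i ≠ j then y γ lam i j • (e j j ⊗ₖ (e i i - e i j)) else 0

def DInf (γ : ℂ) (lam : Fin n → ℂ) : Mat2 n :=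
  1 + ∑ i : Fin n, ∑ j : Fin n,
    if i ≠ j then x γ lam i j • (e i j ⊗ₖ e j i - e i i ⊗ₖ e j j) else 0

/-- The non-constant rational structure matrix `A₁₂(u,v;λ)`. -/
def A (γ u v : ℂ) (lam : Fin n → ℂ) : Mat2 n :=
  AInf γ lam + (γ / (u - v)) • d + (γ / v) • b - (γ / (u + γ)) • flip b

/-- The non-constant rational structure matrix `B₁₂(v;λ)`. -/
def B (γ v : ℂ) (lam : Fin n → ℂ) : Mat2 n :=
  BInf γ lam - (γ / (v + γ)) • b

/-- `C₁₂(u;λ) = B₂₁(u;λ)`. -/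
def C (γ u : ℂ) (lam : Fin n → ℂ) : Mat2 n := flip (B γ u lam)

/-- The non-constant rational structure matrix `D₁₂(w;λ)`, with `w = u - v`. -/
def D (γ w : ℂ) (lam : Fin n → ℂ) : Mat2 n :=
  DInf γ lam + (γ / w) • d

/-- `K₁ = K ⊗ 1`. -/
def in1 (K : Mat n) : Mat2 n := K ⊗ₖ (1 : Mat n)

/-- `K₂ = 1 ⊗ K`. -/
def in2 (K : Mat n) : Mat2 n := (1 : Mat n) ⊗ₖ K

/-- `K₁(λ + γ h₂) = ∑_j K(λ + γ e_j) ⊗ e_{jj}`. -/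
def in1Shift (γ : ℂ) (K : (Fin n → ℂ) → Mat n) (lam : Fin n → ℂ) : Mat2 n :=
  ∑ j : Fin n, K (shift γ j lam) ⊗ₖ e j j

/-- `K₂(λ + γ h₁) = ∑_j e_{jj} ⊗ K(λ + γ e_j)`. -/
def in2Shift (γ : ℂ) (K : (Fin n → ℂ) → Mat n) (lam : Fin n → ℂ) : Mat2 n :=
  ∑ j : Fin n, e j j ⊗ₖ K (shift γ j lam)

/-- A domain for the dynamical variables: stable under the shifts `λ_j ↦ λ_j ± γ`, with pairwise
distinct coordinates. Hence `λ_i - λ_j ∉ γℤ` for `i ≠ j`, and all denominators of `x`, `y` are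
nonzero on it. -/
structure IsDomain (γ : ℂ) (U : Set (Fin n → ℂ)) : Prop where
  nonempty : U.Nonempty
  ne : ∀ lam ∈ U, ∀ i j, i ≠ j → lam i ≠ lam j
  shift_mem : ∀ lam ∈ U, ∀ j, shift γ j lam ∈ U
  shift_neg_mem : ∀ lam ∈ U, ∀ j, shift (-γ) j lam ∈ U

/-- `f` is `γ`-periodic on `U` in each variable `λ_j` with `j ∉ S`. -/
def PeriodicOff (γ : ℂ) (U : Set (Fin n → ℂ)) (S : Set (Fin n)) (f : (Fin n → ℂ) → ℂ) : Prop :=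
  ∀ lam ∈ U, ∀ j, j ∉ S → f (shift γ j lam) = f lam

/-- The matrix function `K(u;λ)` solves the semi-dynamical reflection equation with the
non-constant structure matrices, for `λ ∈ U` and all spectral parameters off the poles. -/
def SolvesSDRE (γ : ℂ) (U : Set (Fin n → ℂ)) (K : ℂ → (Fin n → ℂ) → Mat n) : Prop :=
  ∀ lam ∈ U, ∀ u v : ℂ, u ≠ 0 → v ≠ 0 → u ≠ v → u + γ ≠ 0 → v + γ ≠ 0 →
    A γ u v lam * in1 (K u lam) * B γ v lam * in2Shift γ (K v) lam =
      in2 (K v lam) * C γ u lam * in1Shift γ (K u) lam * D γ (u - v) lam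

/-- The first-order ansatz `K(u;λ) = k⁽⁰⁾(λ) + (γ/u) k⁽¹⁾(λ)`. -/
def firstOrder (γ : ℂ) (k0 k1 : (Fin n → ℂ) → Mat n) (u : ℂ) (lam : Fin n → ℂ) : Mat n :=
  k0 lam + (γ / u) • k1 lam

/-- `Λ_i = ∑_a λ_a - λ_i`. -/
def Lam (lam : Fin n → ℂ) (i : Fin n) : ℂ := (∑ a, lam a) - lam i

/-- `Λ_{ij} = ∑_a λ_a - (λ_i + λ_j)`. -/
def Lam2 (lam : Fin n → ℂ) (i j : Fin n) : ℂ := (∑ a, lam a) - (lam i + lam j)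

/-- `∏_{a ≠ j} γ / (λ_j - λ_a)`. -/
def pref (γ : ℂ) (lam : Fin n → ℂ) (j : Fin n) : ℂ :=
  ∏ a ∈ Finset.univ.erase j, γ / (lam j - lam a)

/-- `∏_{a ≠ j} (1 + f / (λ_j - λ_a))`. -/
def prefII (f : ℂ) (lam : Fin n → ℂ) (j : Fin n) : ℂ :=
  ∏ a ∈ Finset.univ.erase j, (1 + f / (lam j - lam a))

/-- Constant family Ia. -/
def constIa (γ : ℂ) (f : (Fin n → ℂ) → ℂ) (lam : Fin n → ℂ) : Mat n :=
  Matrix.of fun i j => (f lam + lam i) / (f lam + lam j) * pref γ lam j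

/-- Constant family IIa. -/
def constIIa (γ : ℂ) (f : (Fin n → ℂ) → ℂ) (lam : Fin n → ℂ) : Mat n :=
  Matrix.of fun i j => (f lam - Lam2 lam i j) * pref γ lam j

/-- Constant family Ib. -/
def constIb (γ : ℂ) (f : (Fin n → ℂ) → ℂ) (lam : Fin n → ℂ) : Mat n :=
  Matrix.of fun i j => (f lam + Lam lam j) / (f lam + Lam lam i) * pref γ lam j

/-- Constant family IIb. -/
def constIIb (f : (Fin n → ℂ) → ℂ) (lam : Fin n → ℂ) : Mat n :=
  Matrix.of fun i j => f lam / (f lam - (lam i - lam j)) * prefII (f lam) lam j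

/-- Non-constant family Ib. -/
def solIb (γ : ℂ) (f : (Fin n → ℂ) → ℂ) (u : ℂ) (lam : Fin n → ℂ) : Mat n :=
  Matrix.of fun i j =>
    (f lam + Lam lam j) * (1 / (f lam + Lam lam i) - 1 / u) * pref γ lam j

/-- Non-constant family IIb. -/
def solIIb (f : (Fin n → ℂ) → ℂ) (u : ℂ) (lam : Fin n → ℂ) : Mat n :=
  Matrix.of fun i j =>
    f lam * (1 / (f lam - (lam i - lam j)) - 1 / u) * prefII (f lam) lam j

open Classical in
/-- The matrix obtained from `M` by setting the columns with index in `S` to zero. -/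
def zeroCols (S : Set (Fin n)) (M : Mat n) : Mat n :=
  Matrix.of fun i j => if j ∈ S then 0 else M i j

/-- `k0` has a first-order extension solving the reflection equation. -/
def Extends (γ : ℂ) (U : Set (Fin n → ℂ)) (k0 : (Fin n → ℂ) → Mat n) : Prop :=
  ∃ k1 : (Fin n → ℂ) → Mat n, SolvesSDRE γ U (firstOrder γ k0 k1)

/-- `K` is a first-order extension of `k0` which solves the reflection equation, its coefficient
`k1` has no zero entry outside the columns in `S`, and every `k1'` (with no condition on zero
entries) giving a first-order solution agrees with `k1` on `U`. -/
def ExtendsUniquelyTo (γ : ℂ) (U : Set (Fin n → ℂ)) (S : Set (Fin n))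
    (k0 : (Fin n → ℂ) → Mat n) (K : ℂ → (Fin n → ℂ) → Mat n) : Prop :=
  ∃ k1 : (Fin n → ℂ) → Mat n,
    (∀ lam ∈ U, ∀ u : ℂ, u ≠ 0 → K u lam = firstOrder γ k0 k1 u lam) ∧
    (∀ lam ∈ U, ∀ i j, j ∉ S → k1 lam i j ≠ 0) ∧
    SolvesSDRE γ U K ∧
    ∀ k1' : (Fin n → ℂ) → Mat n, SolvesSDRE γ U (firstOrder γ k0 k1') →
      ∀ lam ∈ U, k1' lam = k1 lam

end ACF

end

/-!
Written in entries, the reflection equation is a family of scalar equations indexed by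
`i, k, j, l` (`solvesSDRE_iff_entryEq`). They involve only the entries of `K` and the numbers
`dressed`, the entries of `B₁₂ K₂(λ + γ h₁)`.

*Necessary conditions.* For a first-order `K = k0 + (γ/u) k1` the equations with `i = k` already
suffice. Their double pole at `v = 0` shows that all rows of `k1` agree
(`SolvesSDRE.row_eq`). Their residue at `u = -γ` then gives two facts. A zero column of `k0` forces
a zero column of `k1` (`SolvesSDRE.column_eq_zero`). For a nonvanishing column `j`, the single
unknown `k1 j j` satisfies one linear equation for each row `k ≠ j`
(`SolvesSDRE.coeff_mul_eq`). Each column of the families Ib and IIb is of the form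
`g R / (g - (λ_k - λ_j))`, and the equation determines `k1 j j = -g R / γ`
(`SolvesSDRE.coeff_of_pole`). Each column of the families Ia and IIa is of the form
`(1 + (λ_k - λ_j) / g) R`, and the equation gives `k1 j j = -(g + λ_k - λ_j) R / γ`. With at least
two rows `k ≠ j` these values contradict each other (`SolvesSDRE.false_of_affine`).

*Existence.* The nonzero columns of the proposed solutions are `c_j (1 / (α_j - λ_i) - 1 / u)`. The
dressed entries have the same shape with `u + γ` in place of `u` (`dressed_of_pole`), so that the
equations become identities between rational functions of a few variables
(`solvesSDRE_of_poles`). For Ib all `α_j` equal `f + ∑ λ_a`, and for IIb `α_j = f + λ_j`. Only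
shifts in directions `j ∉ S` occur, because columns in `S` make both sides vanish. For
`(1 + f'/u) 1` the scalar factors out by periodicity, and the identity matrix is checked entrywise
(`entryEq_one`).
-/

namespace ACF

variable {n : ℕ}

/-! ### Entries of the reflection equation -/

lemma e_kronecker_mul_apply (i j k l : Fin n) (X : Mat2 n) (p q : Fin n) (c : Fin n × Fin n) :
    ((e i j ⊗ₖ e k l) * X) (p, q) c = if p = i ∧ q = k then X (j, l) c else 0 := by
  rw [e, e, Matrix.single_kronecker_single, mul_one]
  split_ifs with h
  · rw [h.1, h.2, Matrix.single_mul_apply_same, one_mul]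
  · exact Matrix.single_mul_apply_of_ne _ _ _ _ _ (by simpa using h) _

lemma mul_e_kronecker_apply (i j k l : Fin n) (X : Mat2 n) (p q : Fin n) (c : Fin n × Fin n) :
    (X * (e i j ⊗ₖ e k l)) c (p, q) = if p = j ∧ q = l then X c (i, k) else 0 := by
  rw [e, e, Matrix.single_kronecker_single, mul_one]
  split_ifs with h
  · rw [h.1, h.2, Matrix.mul_single_apply_same, mul_one]
  · exact Matrix.mul_single_apply_of_ne _ _ _ _ _ (by simpa using h) _

lemma sub_kronecker' (M N P : Mat n) : (M - N) ⊗ₖ P = M ⊗ₖ P - N ⊗ₖ P := by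
  ext; simp [sub_mul]

lemma kronecker_sub' (M N P : Mat n) : M ⊗ₖ (N - P) = M ⊗ₖ N - M ⊗ₖ P := by
  ext; simp [mul_sub]

lemma flip_mul (M X : Mat2 n) : flip M * X = flip (M * flip X) := by
  ext ⟨i, k⟩ ⟨j, l⟩
  simp only [flip, Matrix.mul_apply, Matrix.submatrix_apply, Prod.swap]
  exact Fintype.sum_equiv (Equiv.prodComm _ _) _ _ fun p => rfl

lemma d_mul_apply (X : Mat2 n) (i k : Fin n) (c : Fin n × Fin n) :
    ((d : Mat2 n) * X) (i, k) c = X (k, i) c := by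
  simp only [d, Matrix.sum_mul, Matrix.sum_apply, e_kronecker_mul_apply, ite_and]
  simp

lemma b_mul_apply (X : Mat2 n) (i k : Fin n) (c : Fin n × Fin n) :
    ((b : Mat2 n) * X) (i, k) c = X (i, i) c := by
  simp only [b, Matrix.sum_mul, Matrix.sum_apply, e_kronecker_mul_apply, ite_and]
  simp

lemma AInf_mul_apply (γ : ℂ) (lam : Fin n → ℂ) (X : Mat2 n) (i k : Fin n) (c : Fin n × Fin n) :
    (AInf γ lam * X) (i, k) c = X (i, k) c +
      x γ lam i k * (X (i, k) c - X (i, i) c - X (k, k) c + X (k, i) c) := by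
  have h : ∀ p q : Fin n, ((if p ≠ q then
      x γ lam p q • ((e p p - e p q) ⊗ₖ (e q q - e q p)) else 0 : Mat2 n) * X) (i, k) c =
      if i = p then if k = q then
        x γ lam i k * (X (i, k) c - X (i, i) c - X (k, k) c + X (k, i) c) else 0 else 0 := by
    intro p q
    by_cases hpq : p = q
    · subst hpq
      by_cases hi : i = p <;> by_cases hk : k = p <;> simp [hi, hk, x]
    · rw [if_pos hpq]
      simp only [sub_kronecker', kronecker_sub', Matrix.smul_mul, Matrix.sub_mul,
        Matrix.smul_apply, Matrix.sub_apply, e_kronecker_mul_apply, smul_eq_mul]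
      by_cases hi : i = p <;> by_cases hk : k = q <;> simp [hi, hk]
      left; ring
  rw [AInf, Matrix.add_mul, Matrix.one_mul, Matrix.add_apply]
  simp only [Matrix.sum_mul, Matrix.sum_apply, h]
  simp

lemma BInf_mul_apply (γ : ℂ) (lam : Fin n → ℂ) (X : Mat2 n) (i k : Fin n) (c : Fin n × Fin n) :
    (BInf γ lam * X) (i, k) c = X (i, k) c + y γ lam k i * (X (i, k) c - X (i, i) c) := by
  have h : ∀ p q : Fin n, ((if p ≠ q then
      y γ lam p q • (e q q ⊗ₖ (e p p - e p q)) else 0 : Mat2 n) * X) (i, k) c =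
      if k = p then if i = q then
        y γ lam k i * (X (i, k) c - X (i, i) c) else 0 else 0 := by
    intro p q
    by_cases hpq : p = q
    · subst hpq
      by_cases hi : i = p <;> by_cases hk : k = p <;> simp [hi, hk]
    · rw [if_pos hpq]
      simp only [kronecker_sub', Matrix.smul_mul, Matrix.sub_mul,
        Matrix.smul_apply, Matrix.sub_apply, e_kronecker_mul_apply, smul_eq_mul]
      by_cases hi : i = q <;> by_cases hk : k = p <;> simp [hi, hk]
  rw [BInf, Matrix.add_mul, Matrix.one_mul, Matrix.add_apply]
  simp only [Matrix.sum_mul, Matrix.sum_apply, h]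
  simp

lemma mul_D_apply (γ w : ℂ) (lam : Fin n → ℂ) (X : Mat2 n) (j l : Fin n) (c : Fin n × Fin n) :
    (X * D γ w lam) c (j, l) =
      (1 - x γ lam j l) * X c (j, l) + (γ / w - x γ lam j l) * X c (l, j) := by
  have h : ∀ p q : Fin n, (X * (if p ≠ q then
      x γ lam p q • (e p q ⊗ₖ e q p - e p p ⊗ₖ e q q) else 0 : Mat2 n)) c (j, l) =
      (if j = q then if l = p then x γ lam l j * X c (l, j) else 0 else 0) -
      (if j = p then if l = q then x γ lam j l * X c (j, l) else 0 else 0) := by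
    intro p q
    by_cases hpq : p = q
    · subst hpq
      by_cases hj : j = p <;> by_cases hl : l = p <;> simp [hj, hl]
    · rw [if_pos hpq]
      simp only [Matrix.mul_smul,
        Matrix.smul_apply, Matrix.sub_apply, mul_e_kronecker_apply, smul_eq_mul, ite_and, mul_sub]
      congr 1 <;> split_ifs <;> simp_all
  have hd : (X * (d : Mat2 n)) c (j, l) = X c (l, j) := by
    simp only [d, Matrix.mul_sum, Matrix.sum_apply, mul_e_kronecker_apply, ite_and]
    simp
  have hx : x γ lam l j = - x γ lam j l := by
    rw [x, x, ← neg_sub (lam j), div_neg]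
  rw [D, DInf, Matrix.mul_add, Matrix.mul_add, Matrix.mul_one, Matrix.mul_smul, Matrix.add_apply,
    Matrix.add_apply, Matrix.smul_apply, hd]
  simp only [Matrix.mul_sum, Matrix.sum_apply, h, Finset.sum_sub_distrib]
  simp [hx]
  ring

lemma A_mul_apply (γ u v : ℂ) (lam : Fin n → ℂ) (X : Mat2 n) (i k : Fin n) (c : Fin n × Fin n) :
    (A γ u v lam * X) (i, k) c = X (i, k) c +
      x γ lam i k * (X (i, k) c - X (i, i) c - X (k, k) c + X (k, i) c) +
      γ / (u - v) * X (k, i) c + γ / v * X (i, i) c - γ / (u + γ) * X (k, k) c := by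
  have hf : (flip (b : Mat2 n) * X) (i, k) c = X (k, k) c := by
    obtain ⟨p, q⟩ := c
    rw [flip_mul]
    exact b_mul_apply (flip X) k i (q, p)
  simp only [A, Matrix.sub_mul, Matrix.add_mul, Matrix.smul_mul, Matrix.sub_apply, Matrix.add_apply,
    Matrix.smul_apply, AInf_mul_apply, d_mul_apply, b_mul_apply, hf, smul_eq_mul]

lemma in1_mul_apply (K : Mat n) (X : Mat2 n) (i k : Fin n) (c : Fin n × Fin n) :
    (in1 K * X) (i, k) c = ∑ p, K i p * X (p, k) c := by
  simp [in1, Matrix.mul_apply, Fintype.sum_prod_type, Matrix.one_apply]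

lemma in2_mul_apply (K : Mat n) (X : Mat2 n) (i k : Fin n) (c : Fin n × Fin n) :
    (in2 K * X) (i, k) c = ∑ p, K k p * X (i, p) c := by
  simp [in2, Matrix.mul_apply, Fintype.sum_prod_type, Matrix.one_apply]

lemma in2Shift_apply (γ : ℂ) (K : (Fin n → ℂ) → Mat n) (lam : Fin n → ℂ) (i k j l : Fin n) :
    in2Shift γ K lam (i, k) (j, l) = if i = j then K (shift γ j lam) k l else 0 := by
  simp only [in2Shift, Matrix.sum_apply, Matrix.kronecker_apply, e, Matrix.single_apply]
  by_cases h : i = j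
  · subst h; simp
  · rw [if_neg h]
    refine Finset.sum_eq_zero fun p _ => ?_
    rw [if_neg (by rintro ⟨rfl, rfl⟩; exact h rfl), zero_mul]

lemma flip_in1Shift (γ : ℂ) (K : (Fin n → ℂ) → Mat n) (lam : Fin n → ℂ) :
    flip (in1Shift γ K lam) = in2Shift γ K lam := by
  ext ⟨i, k⟩ ⟨j, l⟩
  simp [flip, in1Shift, in2Shift, Matrix.sum_apply, mul_comm]

/-- The entry `(j, k), (j, l)` of `B₁₂(v; λ) K₂(v; λ + γ h₁)`, an operator which is block diagonal
in the first tensor factor. The same numbers, with the factors exchanged, are the entries of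
`C₁₂(v; λ) K₁(v; λ + γ h₂)`. -/
noncomputable def dressed (γ v : ℂ) (K : (Fin n → ℂ) → Mat n) (lam : Fin n → ℂ) (j k l : Fin n) :
    ℂ :=
  (1 + y γ lam k j) * K (shift γ j lam) k l -
    (y γ lam k j + γ / (v + γ)) * K (shift γ j lam) j l

lemma B_mul_in2Shift_apply (γ v : ℂ) (K : (Fin n → ℂ) → Mat n) (lam : Fin n → ℂ)
    (i k j l : Fin n) :
    (B γ v lam * in2Shift γ K lam) (i, k) (j, l) =
      if i = j then dressed γ v K lam j k l else 0 := by
  simp only [B, Matrix.sub_mul, Matrix.smul_mul, Matrix.sub_apply, Matrix.smul_apply,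
    BInf_mul_apply, b_mul_apply, in2Shift_apply, smul_eq_mul, dressed]
  by_cases h : i = j
  · subst h; simp only [if_true]; ring
  · simp [h]

lemma C_mul_in1Shift_apply (γ u : ℂ) (K : (Fin n → ℂ) → Mat n) (lam : Fin n → ℂ)
    (i k j l : Fin n) :
    (C γ u lam * in1Shift γ K lam) (i, k) (j, l) =
      if k = l then dressed γ u K lam l i j else 0 := by
  rw [C, flip_mul, flip_in1Shift]
  exact B_mul_in2Shift_apply γ u K lam k i l j

/-- The entry `(i, k), (j, l)` of the reflection equation. Since `x γ lam i i = 0`, the cases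
`i = k` and `j = l` are covered as well. -/
def EntryEq (γ : ℂ) (K : ℂ → (Fin n → ℂ) → Mat n) (lam : Fin n → ℂ) (u v : ℂ)
    (i k j l : Fin n) : Prop :=
  K u lam i j * dressed γ v (K v) lam j k l +
      x γ lam i k * ((K u lam i j - K u lam k j) *
        (dressed γ v (K v) lam j k l - dressed γ v (K v) lam j i l)) +
      γ / (u - v) * (K u lam k j * dressed γ v (K v) lam j i l) +
      γ / v * (K u lam i j * dressed γ v (K v) lam j i l) -
      γ / (u + γ) * (K u lam k j * dressed γ v (K v) lam j k l) =
    (1 - x γ lam j l) * (K v lam k l * dressed γ u (K u) lam l i j) +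
      (γ / (u - v) - x γ lam j l) * (K v lam k j * dressed γ u (K u) lam j i l)

theorem solvesSDRE_iff_entryEq (γ : ℂ) (U : Set (Fin n → ℂ)) (K : ℂ → (Fin n → ℂ) → Mat n) :
    SolvesSDRE γ U K ↔ ∀ lam ∈ U, ∀ u v : ℂ, u ≠ 0 → v ≠ 0 → u ≠ v → u + γ ≠ 0 → v + γ ≠ 0 →
      ∀ i k j l, EntryEq γ K lam u v i k j l := by
  have hL : ∀ lam u v i k j l,
      (in1 (K u lam) * (B γ v lam * in2Shift γ (K v) lam)) (i, k) (j, l) =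
        K u lam i j * dressed γ v (K v) lam j k l := by
    intro lam u v i k j l
    simp [in1_mul_apply, B_mul_in2Shift_apply]
  have hR : ∀ lam u v i k j l,
      (in2 (K v lam) * (C γ u lam * in1Shift γ (K u) lam)) (i, k) (j, l) =
        K v lam k l * dressed γ u (K u) lam l i j := by
    intro lam u v i k j l
    simp [in2_mul_apply, C_mul_in1Shift_apply]
  have key : ∀ lam u v, (A γ u v lam * in1 (K u lam) * B γ v lam * in2Shift γ (K v) lam =
      in2 (K v lam) * C γ u lam * in1Shift γ (K u) lam * D γ (u - v) lam) ↔
      ∀ i k j l, EntryEq γ K lam u v i k j l := by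
    intro lam u v
    rw [Matrix.mul_assoc (A γ u v lam * in1 (K u lam)), Matrix.mul_assoc (A γ u v lam),
      Matrix.mul_assoc (in2 (K v lam)), ← Matrix.ext_iff]
    simp only [Prod.forall, A_mul_apply, mul_D_apply, hL, hR, EntryEq]
    refine forall_congr' fun i => forall_congr' fun k => forall_congr' fun j =>
      forall_congr' fun l => ?_
    constructor <;> intro h <;> linear_combination h
  simp only [SolvesSDRE, key]

/-! ### Necessary conditions on the first-order coefficient -/

lemma eq_of_eqOn_compl_finite {F G : ℂ → ℂ} (hF : Continuous F) (hG : Continuous G) {s : Set ℂ}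
    (hs : s.Finite) (h : ∀ z, z ∉ s → F z = G z) (z : ℂ) : F z = G z :=
  congrFun (hF.ext_on (hs.countable.dense_compl ℝ) hG fun w hw => h w hw) z

lemma shift_shift_neg (γ : ℂ) (j : Fin n) (lam : Fin n → ℂ) :
    shift γ j (shift (-γ) j lam) = lam := by
  simp [shift, add_assoc, ← Pi.single_add]

lemma IsDomain.sub_ne_zero {γ : ℂ} {U : Set (Fin n → ℂ)} (hU : IsDomain γ U) {lam : Fin n → ℂ}
    (hlam : lam ∈ U) {i j : Fin n} (hij : i ≠ j) : lam i - lam j ≠ 0 :=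
  _root_.sub_ne_zero.2 (hU.ne lam hlam i j hij)

lemma IsDomain.sub_sub_ne_zero {γ : ℂ} {U : Set (Fin n → ℂ)} (hU : IsDomain γ U) (hγ : γ ≠ 0)
    {lam : Fin n → ℂ} (hlam : lam ∈ U) (i j : Fin n) : lam i - lam j - γ ≠ 0 := by
  by_cases hij : i = j
  · simpa [hij] using hγ
  · have := hU.sub_ne_zero (hU.shift_mem lam hlam j) hij
    intro h
    apply this
    simp only [shift, Pi.add_apply, Pi.single_eq_same, Pi.single_eq_of_ne hij]
    linear_combination h

lemma IsDomain.one_add_y_ne_zero {γ : ℂ} {U : Set (Fin n → ℂ)} (hU : IsDomain γ U) (hγ : γ ≠ 0)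
    {lam : Fin n → ℂ} (hlam : lam ∈ U) {i j : Fin n} (hij : i ≠ j) : 1 + y γ lam i j ≠ 0 := by
  have h1 := hU.sub_ne_zero hlam hij
  have h2 := hU.sub_sub_ne_zero hγ hlam i j
  rw [y, one_add_div h2, sub_add_cancel]
  exact div_ne_zero h1 h2

/-- The diagonal case `i = k` of the entry equations, cleared of the denominators which do not
come from `K` itself. -/
lemma EntryEq.diagonal {γ : ℂ} {K : ℂ → (Fin n → ℂ) → Mat n} {lam : Fin n → ℂ} {u v : ℂ}
    {k j l : Fin n} (h : EntryEq γ K lam u v k k j l) (hv : v ≠ 0) (huv : u ≠ v)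
    (hu' : u + γ ≠ 0) :
    u * (v + γ) * (u - v + γ) * (K u lam k j * dressed γ v (K v) lam j k l) =
      (u + γ) * v * ((1 - x γ lam j l) * (u - v) * (K v lam k l * dressed γ u (K u) lam l k j) +
        (γ - x γ lam j l * (u - v)) * (K v lam k j * dressed γ u (K u) lam j k l)) := by
  have huv' : u - v ≠ 0 := sub_ne_zero.2 huv
  unfold EntryEq at h
  generalize dressed γ v (K v) lam j k l = a at *
  generalize dressed γ u (K u) lam l k j = b at *
  generalize dressed γ u (K u) lam j k l = c at *
  generalize K u lam k j = p at *
  generalize K v lam k j = q at *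
  generalize K v lam k l = r at *
  generalize x γ lam j l = t at *
  simp only [sub_self, mul_zero, add_zero] at h
  field_simp at h
  linear_combination h

lemma firstOrder_cleared {γ : ℂ} (k0 k1 : (Fin n → ℂ) → Mat n) {u : ℂ} (lam : Fin n → ℂ)
    (hu : u ≠ 0) {i j : Fin n} :
    u * k0 lam i j + γ * k1 lam i j = u * firstOrder γ k0 k1 u lam i j := by
  simp only [firstOrder, Matrix.add_apply, Matrix.smul_apply, smul_eq_mul]
  field_simp

lemma dressed_firstOrder {γ v : ℂ} {k0 k1 : (Fin n → ℂ) → Mat n} {lam : Fin n → ℂ}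
    {j k l : Fin n} (hv : v ≠ 0) (hv' : v + γ ≠ 0) :
    v * (v + γ) * dressed γ v (firstOrder γ k0 k1 v) lam j k l =
      (v + γ) * ((1 + y γ lam k j) * (v * k0 (shift γ j lam) k l + γ * k1 (shift γ j lam) k l) -
          y γ lam k j * (v * k0 (shift γ j lam) j l + γ * k1 (shift γ j lam) j l)) -
        γ * (v * k0 (shift γ j lam) j l + γ * k1 (shift γ j lam) j l) := by
  simp only [firstOrder_cleared _ _ _ hv, dressed]
  field_simp
  ring

/-- The double pole of the equation at `v = 0` makes the columns of `k1` constant. -/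
lemma SolvesSDRE.row_eq_shift {γ : ℂ} {U : Set (Fin n → ℂ)} (hU : IsDomain γ U) (hγ : γ ≠ 0)
    {k0 k1 : (Fin n → ℂ) → Mat n} (h : SolvesSDRE γ U (firstOrder γ k0 k1))
    {lam : Fin n → ℂ} (hlam : lam ∈ U) {k j : Fin n} (l : Fin n) (hk : k0 lam k j ≠ 0) :
    k1 (shift γ j lam) k l = k1 (shift γ j lam) j l := by
  by_cases hkj : k = j
  · rw [hkj]
  rw [solvesSDRE_iff_entryEq] at h
  set lam' := shift γ j lam
  -- the equation times `v ^ 2 * (u - v)` is polynomial in `v`, hence holds at `v = 0` too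
  have key : ∀ u : ℂ, u ≠ 0 → u + γ ≠ 0 →
      (u * k0 lam k j + γ * k1 lam k j) * (k1 lam' k l - k1 lam' j l) = 0 := by
    intro u hu hu'
    have := eq_of_eqOn_compl_finite
      (F := fun v => (u - v + γ) * (u * k0 lam k j + γ * k1 lam k j) *
        ((v + γ) * ((1 + y γ lam k j) * (v * k0 lam' k l + γ * k1 lam' k l) -
          y γ lam k j * (v * k0 lam' j l + γ * k1 lam' j l)) -
          γ * (v * k0 lam' j l + γ * k1 lam' j l)))
      (G := fun v => (u + γ) * v * ((1 - x γ lam j l) * (u - v) *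
        ((v * k0 lam k l + γ * k1 lam k l) * dressed γ u (firstOrder γ k0 k1 u) lam l k j) +
        (γ - x γ lam j l * (u - v)) *
        ((v * k0 lam k j + γ * k1 lam k j) * dressed γ u (firstOrder γ k0 k1 u) lam j k l)))
      (by fun_prop) (by fun_prop) (s := {0, u, -γ}) (by simp) (fun v hv => by
        simp only [Set.mem_insert_iff, Set.mem_singleton_iff, not_or] at hv
        obtain ⟨hv, huv, hvγ⟩ := hv
        have hv' : v + γ ≠ 0 := fun h => hvγ (eq_neg_of_add_eq_zero_left h)
        have hd := (h lam hlam u v hu hv (Ne.symm huv) hu' hv' k k j l).diagonal hv (Ne.symm huv)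
          hu'
        have e := dressed_firstOrder (γ := γ) (k0 := k0) (k1 := k1) (lam := lam) (j := j) (k := k)
          (l := l) hv hv'
        simp only [firstOrder_cleared _ _ _ hu, firstOrder_cleared _ _ _ hv,
          show shift γ j lam = lam' from rfl] at e ⊢
        linear_combination v * hd - (u - v + γ) * u * firstOrder γ k0 k1 u lam k j * e) 0
    have hy := hU.one_add_y_ne_zero hγ hlam hkj
    have h2 : (u + γ) * γ ^ 2 * (1 + y γ lam k j) * ((u * k0 lam k j + γ * k1 lam k j) *
        (k1 lam' k l - k1 lam' j l)) = 0 := by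
      linear_combination this
    exact (mul_eq_zero.1 h2).resolve_left
      (mul_ne_zero (mul_ne_zero hu' (pow_ne_zero 2 hγ)) hy)
  -- the first factor is affine in `u` with slope `k0 k j`
  have h1 := key γ hγ (by rw [← two_mul]; simpa using hγ)
  have h2 := key (2 * γ) (by simpa using hγ) (by
    rw [show 2 * γ + γ = 3 * γ by ring]; simpa using hγ)
  have h3 : γ * k0 lam k j * (k1 lam' k l - k1 lam' j l) = 0 := by linear_combination h2 - h1
  exact sub_eq_zero.1 ((mul_eq_zero.1 h3).resolve_left (mul_ne_zero hγ hk))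

lemma SolvesSDRE.row_eq {γ : ℂ} {U : Set (Fin n → ℂ)} (hU : IsDomain γ U) (hγ : γ ≠ 0)
    {k0 k1 : (Fin n → ℂ) → Mat n} (h : SolvesSDRE γ U (firstOrder γ k0 k1))
    {j : Fin n} (hj : ∀ lam ∈ U, ∀ i, k0 lam i j ≠ 0) {lam : Fin n → ℂ} (hlam : lam ∈ U)
    (k k' l : Fin n) : k1 lam k l = k1 lam k' l := by
  have key : ∀ i, k1 lam i l = k1 lam j l := fun i => by
    have hm := hU.shift_neg_mem lam hlam j
    have := h.row_eq_shift hU hγ hm (k := i) l (hj _ hm i)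
    rwa [shift_shift_neg] at this
  rw [key k, key k']

lemma dressed_firstOrder_of_row_eq {γ v : ℂ} {k0 k1 : (Fin n → ℂ) → Mat n} {lam : Fin n → ℂ}
    {j k l : Fin n} (hv : v ≠ 0) (hv' : v + γ ≠ 0)
    (h : k1 (shift γ j lam) k l = k1 (shift γ j lam) j l) :
    (v + γ) * dressed γ v (firstOrder γ k0 k1 v) lam j k l =
      (v + γ) * ((1 + y γ lam k j) * k0 (shift γ j lam) k l - y γ lam k j * k0 (shift γ j lam) j l)
        + γ * (k1 (shift γ j lam) j l - k0 (shift γ j lam) j l) := by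
  simp only [dressed, firstOrder, Matrix.add_apply, Matrix.smul_apply, smul_eq_mul, h]
  field_simp
  ring

/-- The residue of the diagonal entry equations at `u = -γ`, for a coefficient `k1` whose columns
are constant. -/
lemma SolvesSDRE.residue_eq {γ : ℂ} {U : Set (Fin n → ℂ)} (hU : IsDomain γ U) (hγ : γ ≠ 0)
    {k0 k1 : (Fin n → ℂ) → Mat n} (h : SolvesSDRE γ U (firstOrder γ k0 k1))
    (hrow : ∀ lam ∈ U, ∀ k k' l, k1 lam k l = k1 lam k' l)
    {lam : Fin n → ℂ} (hlam : lam ∈ U) (k j l : Fin n) {v : ℂ} (hv : v ≠ 0) (hv' : v + γ ≠ 0) :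
    v * (k1 lam k j - k0 lam k j) *
      ((v + γ) * ((1 + y γ lam k j) * k0 (shift γ j lam) k l - y γ lam k j * k0 (shift γ j lam) j l)
        + γ * (k1 (shift γ j lam) j l - k0 (shift γ j lam) j l)) =
    (1 - x γ lam j l) * (v + γ) * (v * k0 lam k l + γ * k1 lam k l) *
        (k1 (shift γ l lam) l j - k0 (shift γ l lam) l j) -
      (γ + x γ lam j l * (v + γ)) * (v * k0 lam k j + γ * k1 lam k j) *
        (k1 (shift γ j lam) j l - k0 (shift γ j lam) j l) := by
  rw [solvesSDRE_iff_entryEq] at h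
  set w := (1 + y γ lam k j) * k0 (shift γ j lam) k l - y γ lam k j * k0 (shift γ j lam) j l with hw
  set w' := (1 + y γ lam k l) * k0 (shift γ l lam) k j - y γ lam k l * k0 (shift γ l lam) l j
    with hw'
  set c := k1 (shift γ j lam) j l - k0 (shift γ j lam) j l with hc
  set c' := k1 (shift γ l lam) l j - k0 (shift γ l lam) l j with hc'
  have := eq_of_eqOn_compl_finite
    (F := fun u => (u - v + γ) * (u * k0 lam k j + γ * k1 lam k j) * ((v + γ) * w + γ * c))
    (G := fun u => (1 - x γ lam j l) * (u - v) * (v * k0 lam k l + γ * k1 lam k l) *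
        ((u + γ) * w' + γ * c') +
      (γ - x γ lam j l * (u - v)) * (v * k0 lam k j + γ * k1 lam k j) * ((u + γ) * w + γ * c))
    -- cleared of denominators, the equation is polynomial in `u` and extends to `u = -γ`
    (by fun_prop) (by fun_prop) (s := {0, v, -γ}) (by simp) (fun u hu => by
      simp only [Set.mem_insert_iff, Set.mem_singleton_iff, not_or] at hu
      obtain ⟨hu, huv, huγ⟩ := hu
      have hu' : u + γ ≠ 0 := fun h => huγ (eq_neg_of_add_eq_zero_left h)
      have hd := (h lam hlam u v hu hv huv hu' hv' k k j l).diagonal hv huv hu'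
      have e1 := dressed_firstOrder_of_row_eq (k0 := k0) hv hv'
        (hrow _ (hU.shift_mem lam hlam j) k j l)
      have e2 := dressed_firstOrder_of_row_eq (k0 := k0) hu hu'
        (hrow _ (hU.shift_mem lam hlam j) k j l)
      have e3 := dressed_firstOrder_of_row_eq (k0 := k0) hu hu'
        (hrow _ (hU.shift_mem lam hlam l) k l j)
      rw [← hw, ← hc] at e1 e2
      rw [← hw', ← hc'] at e3
      simp only [firstOrder_cleared _ _ _ hu, firstOrder_cleared _ _ _ hv, ← e1, ← e2, ← e3]
      linear_combination hd) (-γ)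
  have h2 : γ * (v * (k1 lam k j - k0 lam k j) * ((v + γ) * w + γ * c)) =
      γ * ((1 - x γ lam j l) * (v + γ) * (v * k0 lam k l + γ * k1 lam k l) * c' -
      (γ + x γ lam j l * (v + γ)) * (v * k0 lam k j + γ * k1 lam k j) * c) := by
    linear_combination -this
  exact mul_left_cancel₀ hγ h2

/-- The equation in which only column `j` occurs. Its instance `k = j` says that
`k1 j j / k0 j j` is invariant under the shift of `λ_j`; the other instances determine this
ratio. -/
lemma SolvesSDRE.column_eq {γ : ℂ} {U : Set (Fin n → ℂ)} (hU : IsDomain γ U) (hγ : γ ≠ 0)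
    {k0 k1 : (Fin n → ℂ) → Mat n} (h : SolvesSDRE γ U (firstOrder γ k0 k1))
    (hrow : ∀ lam ∈ U, ∀ k k' l, k1 lam k l = k1 lam k' l)
    {lam : Fin n → ℂ} (hlam : lam ∈ U) (k j : Fin n) :
    (k0 lam k j - k1 lam j j) *
      ((1 + y γ lam k j) * k0 (shift γ j lam) k j - y γ lam k j * k0 (shift γ j lam) j j) =
    k0 lam k j * (k0 (shift γ j lam) j j - k1 (shift γ j lam) j j) := by
  have hx : x γ lam j j = 0 := by simp [x]
  -- for `j = l` the two sides differ by a multiple of `v * (v + γ)`, so any value of `v` will do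
  have h1 := h.residue_eq hU hγ hrow hlam k j j hγ (by rw [← two_mul]; simpa using hγ)
  rw [hx, hrow lam hlam k j j] at h1
  refine mul_left_cancel₀ (mul_ne_zero two_ne_zero (pow_ne_zero 2 hγ)) ?_
  linear_combination -h1

/-- A vanishing column of `k0` forces the same column of `k1` to vanish, provided that some other
column of `k0` has no zero entry. -/
theorem SolvesSDRE.column_eq_zero {γ : ℂ} {U : Set (Fin n → ℂ)} (hU : IsDomain γ U) (hγ : γ ≠ 0)
    {k0 k1 : (Fin n → ℂ) → Mat n} (h : SolvesSDRE γ U (firstOrder γ k0 k1)) {j l : Fin n}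
    (hj : ∀ lam ∈ U, ∀ i, k0 lam i j ≠ 0) (hl : ∀ lam ∈ U, ∀ i, k0 lam i l = 0)
    {lam : Fin n → ℂ} (hlam : lam ∈ U) (i : Fin n) : k1 lam i l = 0 := by
  have hrow : ∀ lam ∈ U, ∀ k k' l, k1 lam k l = k1 lam k' l :=
    fun lam hlam k k' l => h.row_eq hU hγ hj hlam k k' l
  have hjl : j ≠ l := by
    rintro rfl
    exact hj lam hlam j (hl lam hlam j)
  rw [hrow lam hlam i j l, ← shift_shift_neg γ j lam]
  set mu := shift (-γ) j lam
  have hmu : mu ∈ U := hU.shift_neg_mem lam hlam j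
  have n2 : 2 * γ ≠ 0 := by simpa using hγ
  have n3 : 3 * γ ≠ 0 := by simpa using hγ
  have n4 : 4 * γ ≠ 0 := by simpa using hγ
  have h1 := h.residue_eq hU hγ hrow hmu j j l hγ (by rwa [← two_mul])
  have h2 := h.residue_eq hU hγ hrow hmu j j l n2 (by convert n3 using 1; ring)
  have h3 := h.residue_eq hU hγ hrow hmu j j l n3 (by convert n4 using 1; ring)
  simp only [hl mu hmu, hl _ (hU.shift_mem mu hmu j)] at h1 h2 h3
  have hx : x γ mu j l ≠ 0 := div_ne_zero hγ (hU.sub_ne_zero hmu hjl)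
  -- the equation is quadratic in `v`; its leading coefficient is the second difference
  have h4 : 2 * γ ^ 2 * (x γ mu j l * k0 mu j j) * k1 (shift γ j mu) j l = 0 := by
    linear_combination h3 - 2 * h2 + h1
  exact (mul_eq_zero.1 h4).resolve_left (mul_ne_zero (mul_ne_zero two_ne_zero (pow_ne_zero 2 hγ))
    (mul_ne_zero hx (hj mu hmu j)))

/-! ### The first-order coefficient of a given column -/

/-- The linear equation for the single unknown `k1 j j` of column `j`, obtained by eliminating the
shifted value of `k1` from `SolvesSDRE.column_eq`. -/
lemma SolvesSDRE.coeff_mul_eq {γ : ℂ} {U : Set (Fin n → ℂ)} (hU : IsDomain γ U) (hγ : γ ≠ 0)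
    {k0 k1 : (Fin n → ℂ) → Mat n} (h : SolvesSDRE γ U (firstOrder γ k0 k1)) {j : Fin n}
    (hj : ∀ lam ∈ U, ∀ i, k0 lam i j ≠ 0) {lam : Fin n → ℂ} (hlam : lam ∈ U) (k : Fin n) :
    k1 lam j j * (k0 lam k j * k0 (shift γ j lam) j j - k0 lam j j *
      ((1 + y γ lam k j) * k0 (shift γ j lam) k j - y γ lam k j * k0 (shift γ j lam) j j)) =
    k0 lam k j * k0 lam j j * (k0 (shift γ j lam) j j -
      ((1 + y γ lam k j) * k0 (shift γ j lam) k j - y γ lam k j * k0 (shift γ j lam) j j)) := by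
  have hrow : ∀ lam ∈ U, ∀ k k' l, k1 lam k l = k1 lam k' l :=
    fun lam hlam k k' l => h.row_eq hU hγ hj hlam k k' l
  have h1 := h.column_eq hU hγ hrow hlam k j
  have h2 := h.column_eq hU hγ hrow hlam j j
  linear_combination k0 lam j j * h1 - k0 lam k j * h2

lemma shift_sub_of_ne (γ : ℂ) (lam : Fin n → ℂ) {j k : Fin n} (h : k ≠ j) :
    shift γ j lam k - shift γ j lam j = lam k - lam j - γ := by
  simp only [shift, Pi.add_apply, Pi.single_eq_same, Pi.single_eq_of_ne h]
  ring

/-- Value of the first-order coefficient for a column `g / (g - (λ_k - λ_j)) * R` of `k0`, with `g`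
invariant under the shift of `λ_j`. -/
lemma SolvesSDRE.coeff_of_pole {γ : ℂ} {U : Set (Fin n → ℂ)} (hU : IsDomain γ U) (hγ : γ ≠ 0)
    {k0 k1 : (Fin n → ℂ) → Mat n} (h : SolvesSDRE γ U (firstOrder γ k0 k1)) {j : Fin n}
    {g R : (Fin n → ℂ) → ℂ} (hR : ∀ lam ∈ U, R lam ≠ 0)
    (hg : ∀ lam ∈ U, ∀ k, g lam - (lam k - lam j) ≠ 0)
    (hshift : ∀ lam ∈ U, g (shift γ j lam) = g lam)
    (hk0 : ∀ lam ∈ U, ∀ k, k0 lam k j = g lam / (g lam - (lam k - lam j)) * R lam)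
    (hn : 2 ≤ n) {lam : Fin n → ℂ} (hlam : lam ∈ U) (i : Fin n) :
    k1 lam i j = -(g lam * R lam) / γ := by
  have hg0 : ∀ lam ∈ U, g lam ≠ 0 := fun lam hlam => by simpa using hg lam hlam j
  have hj : ∀ lam ∈ U, ∀ i, k0 lam i j ≠ 0 := fun lam hlam i => by
    rw [hk0 lam hlam]
    exact mul_ne_zero (div_ne_zero (hg0 lam hlam) (hg lam hlam i)) (hR lam hlam)
  rw [h.row_eq hU hγ hj hlam i j j]
  have : Nontrivial (Fin n) := Fin.nontrivial_iff_two_le.2 hn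
  obtain ⟨k, hkj⟩ := exists_ne j
  have hm := hU.shift_mem lam hlam j
  have e := h.coeff_mul_eq hU hγ hj hlam k
  have n1 := hg lam hlam k
  have n2 := hg _ hm k
  have n3 := hU.sub_ne_zero hlam hkj
  have n4 := hU.sub_sub_ne_zero hγ hlam k j
  rw [hk0 lam hlam, hk0 _ hm, hk0 lam hlam, hk0 _ hm, hshift lam hlam, shift_sub_of_ne γ lam hkj,
    sub_self, sub_self, sub_zero, div_self (hg0 lam hlam), y] at e
  rw [hshift lam hlam, shift_sub_of_ne γ lam hkj] at n2
  have r1 := hR lam hlam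
  have r2 := hR _ hm
  have n5 := hg0 lam hlam
  generalize R (shift γ j lam) = R' at *
  generalize R lam = r at *
  generalize g lam = g at *
  generalize lam k - lam j = s at *
  generalize k1 lam j j = κ at *
  rw [eq_div_iff hγ]
  have n6 : g - s + γ ≠ 0 := by convert n2 using 1; ring
  have hT : r * R' * s / ((g - s) * (g - s + γ)) ≠ 0 :=
    div_ne_zero (mul_ne_zero (mul_ne_zero r1 r2) n3) (mul_ne_zero n1 n6)
  have hw : (1 + γ / (s - γ)) * (g / (g - (s - γ)) * R') - γ / (s - γ) * (1 * R') =
      (g + γ) / (g - s + γ) * R' := by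
    rw [show g - (s - γ) = g - s + γ by ring]
    field_simp
    ring
  rw [hw] at e
  refine mul_left_cancel₀ hT ?_
  have hX : g / (g - s) * r * (1 * R') - 1 * r * ((g + γ) / (g - s + γ) * R') =
      r * R' * s / ((g - s) * (g - s + γ)) * γ := by
    field_simp
    ring
  have hY : g / (g - s) * r * (1 * r) * (1 * R' - (g + γ) / (g - s + γ) * R') =
      r * R' * s / ((g - s) * (g - s + γ)) * -(g * r) := by
    field_simp
    ring
  rw [hX, hY] at e
  linear_combination e

/-- Value of the first-order coefficient for a column `(1 + (λ_k - λ_j) / g) * R` of `k0`, with `g`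
shifted by `γ` together with `λ_j`. It depends on the row `k` chosen to compute it. -/
lemma SolvesSDRE.coeff_of_affine {γ : ℂ} {U : Set (Fin n → ℂ)} (hU : IsDomain γ U) (hγ : γ ≠ 0)
    {k0 k1 : (Fin n → ℂ) → Mat n} (h : SolvesSDRE γ U (firstOrder γ k0 k1)) {j : Fin n}
    {g R : (Fin n → ℂ) → ℂ} (hR : ∀ lam ∈ U, R lam ≠ 0) (hg0 : ∀ lam ∈ U, g lam ≠ 0)
    (hg : ∀ lam ∈ U, ∀ k, g lam + (lam k - lam j) ≠ 0)
    (hshift : ∀ lam ∈ U, g (shift γ j lam) = g lam + γ)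
    (hk0 : ∀ lam ∈ U, ∀ k, k0 lam k j = (1 + (lam k - lam j) / g lam) * R lam)
    {lam : Fin n → ℂ} (hlam : lam ∈ U) {k : Fin n} (hkj : k ≠ j) :
    γ * k1 lam j j = -((g lam + (lam k - lam j)) * R lam) := by
  have hj : ∀ lam ∈ U, ∀ i, k0 lam i j ≠ 0 := fun lam hlam i => by
    rw [hk0 lam hlam, one_add_div (hg0 lam hlam)]
    exact mul_ne_zero (div_ne_zero (hg lam hlam i) (hg0 lam hlam)) (hR lam hlam)
  have hm := hU.shift_mem lam hlam j
  have e := h.coeff_mul_eq hU hγ hj hlam k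
  have n1 := hg0 lam hlam
  have n2 := hg0 _ hm
  have n3 := hU.sub_ne_zero hlam hkj
  have n4 := hU.sub_sub_ne_zero hγ hlam k j
  rw [hk0 lam hlam, hk0 _ hm, hk0 lam hlam, hk0 _ hm, hshift lam hlam, shift_sub_of_ne γ lam hkj,
    sub_self, sub_self, zero_div, zero_div, add_zero, y] at e
  rw [hshift lam hlam] at n2
  have r1 := hR lam hlam
  have r2 := hR _ hm
  generalize R (shift γ j lam) = R' at *
  generalize R lam = r at *
  generalize g lam = g at *
  generalize lam k - lam j = s at *
  generalize k1 lam j j = κ at *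
  have hT : r * R' * s / (g * (g + γ)) ≠ 0 :=
    div_ne_zero (mul_ne_zero (mul_ne_zero r1 r2) n3) (mul_ne_zero n1 n2)
  have hw : (1 + γ / (s - γ)) * ((1 + (s - γ) / (g + γ)) * R') - γ / (s - γ) * (1 * R') =
      (1 + s / (g + γ)) * R' := by
    field_simp
    ring
  rw [hw] at e
  refine mul_left_cancel₀ hT ?_
  have hX : (1 + s / g) * r * (1 * R') - 1 * r * ((1 + s / (g + γ)) * R') =
      r * R' * s / (g * (g + γ)) * γ := by
    field_simp
    ring
  have hY : (1 + s / g) * r * (1 * r) * (1 * R' - (1 + s / (g + γ)) * R') =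
      r * R' * s / (g * (g + γ)) * -((g + s) * r) := by
    field_simp
    ring
  rw [hX, hY] at e
  linear_combination e

lemma SolvesSDRE.false_of_affine {γ : ℂ} {U : Set (Fin n → ℂ)} (hU : IsDomain γ U) (hγ : γ ≠ 0)
    {k0 k1 : (Fin n → ℂ) → Mat n} (h : SolvesSDRE γ U (firstOrder γ k0 k1)) {j : Fin n}
    {g R : (Fin n → ℂ) → ℂ} (hR : ∀ lam ∈ U, R lam ≠ 0) (hg0 : ∀ lam ∈ U, g lam ≠ 0)
    (hg : ∀ lam ∈ U, ∀ k, g lam + (lam k - lam j) ≠ 0)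
    (hshift : ∀ lam ∈ U, g (shift γ j lam) = g lam + γ)
    (hk0 : ∀ lam ∈ U, ∀ k, k0 lam k j = (1 + (lam k - lam j) / g lam) * R lam)
    (hn : 3 ≤ n) : False := by
  obtain ⟨lam, hlam⟩ := hU.nonempty
  obtain ⟨k, hkj, -⟩ := Fin.exists_ne_and_ne_of_two_lt j j hn
  obtain ⟨k', hkj', hkk⟩ := Fin.exists_ne_and_ne_of_two_lt j k hn
  have e1 := h.coeff_of_affine hU hγ hR hg0 hg hshift hk0 hlam hkj
  have e2 := h.coeff_of_affine hU hγ hR hg0 hg hshift hk0 hlam hkj'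
  have : (lam k' - lam k) * R lam = 0 := by linear_combination e2 - e1
  exact mul_ne_zero (hU.sub_ne_zero hlam hkk) (hR lam hlam) this

/-! ### Solutions whose columns have a simple pole -/

/-- The identity behind the equations with `j ≠ l` for IIb, where `a = α_j - λ_i`,
`b = α_j - λ_k`, `t = λ_j - λ_l`, and the shifted poles are `α_l` and `α_j` themselves. The number
`X` is `x γ lam i k`; its hypothesis holds for `i = k` as well, since both sides are then zero. -/
lemma pole_identity_transposed {γ u v a b t q w X : ℂ}
    (ha : a ≠ 0) (hb : b ≠ 0) (hat : a - t ≠ 0) (hbt : b - t ≠ 0)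
    (hu : u ≠ 0) (hv : v ≠ 0) (huv : u - v ≠ 0) (hu' : u + γ ≠ 0) (hv' : v + γ ≠ 0) (ht : t ≠ 0)
    (hqw : w * (t - γ) = q * (t + γ))
    (hX : X * ((1 / a - 1 / b) * (1 / (b - t) - 1 / (a - t))) =
      -γ * (b - a) / (a * b * (a - t) * (b - t))) :
    q * ((1 / a - 1 / u) * (1 / (b - t) - 1 / (v + γ)) +
        X * ((1 / a - 1 / b) * (1 / (b - t) - 1 / (a - t))) +
        γ / (u - v) * ((1 / b - 1 / u) * (1 / (a - t) - 1 / (v + γ))) +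
        γ / v * ((1 / a - 1 / u) * (1 / (a - t) - 1 / (v + γ))) -
        γ / (u + γ) * ((1 / b - 1 / u) * (1 / (b - t) - 1 / (v + γ)))) =
      (1 - γ / t) * w * ((1 / (b - t) - 1 / v) * (1 / a - 1 / (u + γ))) +
      (γ / (u - v) - γ / t) * q * ((1 / b - 1 / v) * (1 / (a - t) - 1 / (u + γ))) := by
  have h : (1 - γ / t) * w = q * (t + γ) / t := by
    field_simp; linear_combination hqw
  rw [hX, h]
  field_simp
  ring

/-- The identity behind the equations with `j ≠ l` for Ib, where `a = α - λ_i`, `b = α - λ_k`,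
`t = λ_j - λ_l`, and both shifted poles are `α + γ`. -/
lemma pole_identity_common {γ u v a b t q w X : ℂ}
    (ha : a ≠ 0) (hb : b ≠ 0) (hat : a + γ ≠ 0) (hbt : b + γ ≠ 0)
    (hu : u ≠ 0) (hv : v ≠ 0) (huv : u - v ≠ 0) (hu' : u + γ ≠ 0) (hv' : v + γ ≠ 0) (ht : t ≠ 0)
    (hqw : w * (t - γ) = q * (t + γ))
    (hX : X * ((1 / a - 1 / b) * (1 / (b + γ) - 1 / (a + γ))) =
      -γ * (b - a) / (a * b * (a + γ) * (b + γ))) :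
    q * ((1 / a - 1 / u) * (1 / (b + γ) - 1 / (v + γ)) +
        X * ((1 / a - 1 / b) * (1 / (b + γ) - 1 / (a + γ))) +
        γ / (u - v) * ((1 / b - 1 / u) * (1 / (a + γ) - 1 / (v + γ))) +
        γ / v * ((1 / a - 1 / u) * (1 / (a + γ) - 1 / (v + γ))) -
        γ / (u + γ) * ((1 / b - 1 / u) * (1 / (b + γ) - 1 / (v + γ)))) =
      (1 - γ / t) * w * ((1 / b - 1 / v) * (1 / (a + γ) - 1 / (u + γ))) +
      (γ / (u - v) - γ / t) * q * ((1 / b - 1 / v) * (1 / (a + γ) - 1 / (u + γ))) := by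
  have h : (1 - γ / t) * w = q * (t + γ) / t := by
    field_simp; linear_combination hqw
  rw [hX, h]
  field_simp
  ring

/-- The identity behind the equations with `j = l`. The numbers `r` and `s` stand for
`τ / (b + γ)` and `τ / (a + γ)`, where a vanishing denominator is allowed if it equals `τ`. -/
lemma pole_identity_same {γ u v a b r s X : ℂ} (ha : a ≠ 0) (hb : b ≠ 0)
    (hu : u ≠ 0) (hv : v ≠ 0) (huv : u - v ≠ 0) (hu' : u + γ ≠ 0) (hv' : v + γ ≠ 0)
    (hrs : (b + γ) * r = (a + γ) * s)
    (hX : X * ((1 / a - 1 / b) * ((v - b) / (v + γ) * r - (v - a) / (v + γ) * s)) =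
      γ / (a * b) * ((v - b) / (v + γ) * r - (v - a) / (v + γ) * s)) :
    (1 / a - 1 / u) * ((v - b) / (v + γ) * r) +
        X * ((1 / a - 1 / b) * ((v - b) / (v + γ) * r - (v - a) / (v + γ) * s)) +
        γ / (u - v) * ((1 / b - 1 / u) * ((v - a) / (v + γ) * s)) +
        γ / v * ((1 / a - 1 / u) * ((v - a) / (v + γ) * s)) -
        γ / (u + γ) * ((1 / b - 1 / u) * ((v - b) / (v + γ) * r)) =
      (1 + γ / (u - v)) * ((1 / b - 1 / v) * ((u - a) / (u + γ) * s)) := by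
  rw [hX]
  -- the difference of the two sides is a multiple of `(b + γ) * r - (a + γ) * s`
  have h : (1 / a - 1 / u) * ((v - b) / (v + γ) * r) +
        γ / (a * b) * ((v - b) / (v + γ) * r - (v - a) / (v + γ) * s) +
        γ / (u - v) * ((1 / b - 1 / u) * ((v - a) / (v + γ) * s)) +
        γ / v * ((1 / a - 1 / u) * ((v - a) / (v + γ) * s)) -
        γ / (u + γ) * ((1 / b - 1 / u) * ((v - b) / (v + γ) * r)) -
      (1 + γ / (u - v)) * ((1 / b - 1 / v) * ((u - a) / (u + γ) * s)) =
      (v - b) * (u + γ - a) / ((v + γ) * a * b * (u + γ)) * ((b + γ) * r - (a + γ) * s) := by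
    field_simp
    ring
  rw [← sub_eq_zero, h, hrs, sub_self, mul_zero]

lemma shift_apply_self (γ : ℂ) (lam : Fin n → ℂ) (j : Fin n) : shift γ j lam j = lam j + γ := by
  simp [shift]

lemma shift_apply_of_ne (γ : ℂ) (lam : Fin n → ℂ) {j k : Fin n} (h : k ≠ j) :
    shift γ j lam k = lam k := by
  simp [shift, h]

/-- If the column `l` of `K` at the shifted point has entries `c * (1 / (α - λ_k) - 1 / v)`, the
dressed entries have the same form, with `v + γ` in place of `v`. The factor written as a
conditional is `(α - λ_j) / (α - λ_k)`, extended to the case that `α = λ_j = λ_k`. -/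
lemma dressed_of_pole {γ v c α : ℂ} {K : (Fin n → ℂ) → Mat n} {lam : Fin n → ℂ} {j l : Fin n}
    (hv : v ≠ 0) (hv' : v + γ ≠ 0)
    (hne : ∀ k, α - shift γ j lam k ≠ 0) (hy : ∀ k, lam k - lam j - γ ≠ 0)
    (hK : ∀ k, K (shift γ j lam) k l = c * (1 / (α - shift γ j lam k) - 1 / v)) (k : Fin n) :
    dressed γ v K lam j k l = c / (α - lam j - γ) *
      ((v + γ - (α - lam k)) / (v + γ) *
        if k = j then 1 else (α - lam j) / (α - lam k)) := by
  have h1 := hne j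
  have h2 := hy k
  rw [shift_apply_self, ← sub_sub] at h1
  rw [dressed, hK, hK, shift_apply_self, ← sub_sub, y]
  split_ifs with hk
  · subst hk
    have hγ : γ ≠ 0 := by simpa using h2
    rw [shift_apply_self, ← sub_sub]
    field_simp
    ring
  · have h3 := hne k
    rw [shift_apply_of_ne γ lam hk] at h3 ⊢
    field_simp
    ring

/-- The form of `dressed_of_pole` without a case distinction, for `α ≠ λ_k`. -/
lemma dressed_of_pole' {γ v c α : ℂ} {K : (Fin n → ℂ) → Mat n} {lam : Fin n → ℂ} {j l : Fin n}
    (hv : v ≠ 0) (hv' : v + γ ≠ 0)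
    (hne : ∀ k, α - shift γ j lam k ≠ 0) (hy : ∀ k, lam k - lam j - γ ≠ 0)
    (hK : ∀ k, K (shift γ j lam) k l = c * (1 / (α - shift γ j lam k) - 1 / v)) (k : Fin n)
    (hk : α - lam k ≠ 0) :
    dressed γ v K lam j k l = c * (α - lam j) / (α - lam j - γ) *
      (1 / (α - lam k) - 1 / (v + γ)) := by
  have h1 := hne j
  rw [shift_apply_self, ← sub_sub] at h1
  rw [dressed_of_pole hv hv' hne hy hK]
  split_ifs with hkj
  · subst hkj
    field_simp
  · field_simp

/-- Sufficient conditions for a matrix with columns `c_j (1 / (α_j - λ_i) - 1 / u)` and zero columns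
in `S` to solve the reflection equation. The poles `α_j` either agree and move with every
variable, or `α_j - λ_j` does not depend on `j` and is constant. The last
hypothesis relates the leading coefficients of the dressed columns `j` and `l`. -/
theorem solvesSDRE_of_poles {γ : ℂ} {U : Set (Fin n → ℂ)} (hU : IsDomain γ U) (hγ : γ ≠ 0)
    {S : Set (Fin n)} {c α : (Fin n → ℂ) → Fin n → ℂ} {K : ℂ → (Fin n → ℂ) → Mat n}
    (hK0 : ∀ lam ∈ U, ∀ u i j, j ∈ S → K u lam i j = 0)
    (hK : ∀ lam ∈ U, ∀ u i j, j ∉ S → K u lam i j = c lam j * (1 / (α lam j - lam i) - 1 / u))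
    (hne : ∀ lam ∈ U, ∀ i j, j ∉ S → α lam j - lam i ≠ 0)
    (hdiag : ∀ lam ∈ U, ∀ j, j ∉ S → α (shift γ j lam) j = α lam j + γ)
    (hα : (∀ lam ∈ U, ∀ j l, j ∉ S → l ∉ S → j ≠ l →
        α lam l = α lam j ∧ α (shift γ j lam) l = α lam j + γ) ∨
      (∀ lam ∈ U, ∀ j l, j ∉ S → l ∉ S → j ≠ l →
        α lam l = α lam j - (lam j - lam l) ∧ α (shift γ j lam) l = α lam l))
    (hc : ∀ lam ∈ U, ∀ j l, j ∉ S → l ∉ S → j ≠ l →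
      c lam l * (c (shift γ l lam) j * (α (shift γ l lam) j - lam l) /
        (α (shift γ l lam) j - lam l - γ)) * (lam j - lam l - γ) =
      c lam j * (c (shift γ j lam) l * (α (shift γ j lam) l - lam j) /
        (α (shift γ j lam) l - lam j - γ)) * (lam j - lam l + γ)) :
    SolvesSDRE γ U K := by
  rw [solvesSDRE_iff_entryEq]
  intro lam hlam u v hu hv huv hu' hv' i k j l
  have hd0 : ∀ u j k l, l ∈ S → dressed γ u (K u) lam j k l = 0 := by
    intro u j k l hl
    simp [dressed, hK0 _ (hU.shift_mem lam hlam j) _ _ l hl]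
  by_cases hj : j ∈ S
  · simp [EntryEq, hK0 lam hlam _ _ j hj, hd0 _ _ _ j hj]
  by_cases hl : l ∈ S
  · simp [EntryEq, hK0 lam hlam _ _ l hl, hd0 _ _ _ l hl]
  have hy : ∀ j k, lam k - lam j - γ ≠ 0 := fun j k => hU.sub_sub_ne_zero hγ hlam k j
  have huv' : u - v ≠ 0 := sub_ne_zero.2 huv
  have ha := hne lam hlam i j hj
  have hb := hne lam hlam k j hj
  have hnes : ∀ j l, l ∉ S → ∀ k, α (shift γ j lam) l - shift γ j lam k ≠ 0 := fun j l hl k =>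
    hne _ (hU.shift_mem lam hlam j) k l hl
  have hKs : ∀ u j l, l ∉ S → ∀ k, K u (shift γ j lam) k l =
      c (shift γ j lam) l * (1 / (α (shift γ j lam) l - shift γ j lam k) - 1 / u) :=
    fun u j l hl k => hK _ (hU.shift_mem lam hlam j) u k l hl
  unfold EntryEq
  by_cases hjl : j = l
  · subst hjl
    have hd : ∀ w : ℂ, w ≠ 0 → w + γ ≠ 0 → ∀ k, dressed γ w (K w) lam j k j =
        c (shift γ j lam) j / (α lam j - lam j) * ((w - (α lam j - lam k)) / (w + γ) *
          if k = j then 1 else (α lam j - lam j + γ) / (α lam j - lam k + γ)) := by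
      intro w hw hw' k
      rw [dressed_of_pole hw hw' (hnes j j hj) (hy j) (hKs w j j hj), hdiag lam hlam j hj]
      ring_nf
    have hx0 : x γ lam j j = 0 := by simp [x]
    rw [hd u hu hu', hd v hv hv', hd v hv hv', hK lam hlam u i j hj, hK lam hlam u k j hj,
      hK lam hlam v k j hj, hx0]
    have hrs : ∀ k, (α lam j - lam k + γ) *
        (if k = j then 1 else (α lam j - lam j + γ) / (α lam j - lam k + γ)) =
        α lam j - lam j + γ := by
      intro k
      split_ifs with hk
      · rw [hk, mul_one]
      · have h := hnes j j hj k
        rw [hdiag lam hlam j hj, shift_apply_of_ne γ lam hk] at h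
        exact mul_div_cancel₀ _ (by convert h using 1; ring)
    have hrs' := (hrs k).trans (hrs i).symm
    set r := if k = j then 1 else (α lam j - lam j + γ) / (α lam j - lam k + γ)
    set s := if i = j then 1 else (α lam j - lam j + γ) / (α lam j - lam i + γ)
    have main := pole_identity_same (X := x γ lam i k) ha hb hu hv huv' hu' hv' hrs' (by
      by_cases hik : i = k
      · subst hik
        simp [r, s]
      · have := hU.sub_ne_zero hlam hik
        rw [x]
        field_simp
        ring)
    linear_combination c lam j * (c (shift γ j lam) j / (α lam j - lam j)) * main
  · have ht := hU.sub_ne_zero hlam hjl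
    have hne' : ∀ j l, j ∉ S → l ∉ S → j ≠ l → ∀ k, α (shift γ j lam) l - lam k ≠ 0 := by
      intro j l hj hl hjl k
      rcases hα with hα | hα
      · by_cases hk : k = j
        -- the nonvanishing comes from the shift of `λ_l`, since the two shifted poles are equal
        · have h := hnes l j hj j
          rw [hk]
          rwa [shift_apply_of_ne γ lam hjl, (hα lam hlam l j hl hj (Ne.symm hjl)).2,
            (hα lam hlam j l hj hl hjl).1, ← (hα lam hlam j l hj hl hjl).2] at h
        · have h := hnes j l hl k
          rwa [shift_apply_of_ne γ lam hk] at h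
      · rw [(hα lam hlam j l hj hl hjl).2]
        exact hne lam hlam k l hl
    have hd : ∀ j l, j ∉ S → l ∉ S → j ≠ l → ∀ w : ℂ, w ≠ 0 → w + γ ≠ 0 → ∀ k,
        dressed γ w (K w) lam j k l = c (shift γ j lam) l * (α (shift γ j lam) l - lam j) /
          (α (shift γ j lam) l - lam j - γ) *
          (1 / (α (shift γ j lam) l - lam k) - 1 / (w + γ)) :=
      fun j l hj hl hjl w hw hw' k => dressed_of_pole' hw hw' (hnes j l hl) (hy j) (hKs w j l hl) k
        (hne' j l hj hl hjl k)
    have hc' := hc lam hlam j l hj hl hjl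
    have ha1 := hne' j l hj hl hjl i
    have hb1 := hne' j l hj hl hjl k
    rw [hd j l hj hl hjl v hv hv', hd j l hj hl hjl v hv hv', hd j l hj hl hjl u hu hu',
      hd l j hl hj (Ne.symm hjl) u hu hu', hK lam hlam u i j hj, hK lam hlam u k j hj,
      hK lam hlam v k j hj, hK lam hlam v k l hl]
    have hxt : x γ lam j l = γ / (lam j - lam l) := rfl
    rw [hxt]
    set M := c (shift γ j lam) l * (α (shift γ j lam) l - lam j) /
          (α (shift γ j lam) l - lam j - γ)
    set M' := c (shift γ l lam) j * (α (shift γ l lam) j - lam l) /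
          (α (shift γ l lam) j - lam l - γ)
    rcases hα with hα | hα
    · have e1 := (hα lam hlam j l hj hl hjl)
      have e2 := (hα lam hlam l j hl hj (Ne.symm hjl))
      rw [e1.1] at e2
      have f : ∀ k, α lam j + γ - lam k = α lam j - lam k + γ := fun k => by ring
      rw [e1.2, f] at ha1 hb1
      rw [e1.2, e2.2, e1.1, f, f]
      have main := pole_identity_common (X := x γ lam i k) ha hb ha1 hb1 hu hv huv' hu' hv'
        ht hc' (by
        by_cases hik : i = k
        · subst hik
          simp
        · have := hU.sub_ne_zero hlam hik
          rw [x]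
          field_simp
          ring)
      linear_combination main
    · have e1 := (hα lam hlam j l hj hl hjl)
      have e2 := (hα lam hlam l j hl hj (Ne.symm hjl))
      have f : ∀ k, α lam j - (lam j - lam l) - lam k = α lam j - lam k - (lam j - lam l) :=
        fun k => by ring
      rw [e1.2, e1.1, f] at ha1 hb1
      rw [e1.2, e2.2, e1.1, f, f]
      have main := pole_identity_transposed (X := x γ lam i k) ha hb ha1 hb1 hu hv huv' hu' hv'
        ht hc' (by
        by_cases hik : i = k
        · subst hik
          simp
        · have := hU.sub_ne_zero hlam hik
          rw [x]
          field_simp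
          ring)
      linear_combination main

/-! ### First-order extensions of the four constant families -/

/-- A matrix as in `solvesSDRE_of_poles` is the only first-order extension of its value at
`u = ∞`. -/
theorem extendsUniquelyTo_of_poles (hn : 2 ≤ n) {γ : ℂ} {U : Set (Fin n → ℂ)} (hU : IsDomain γ U)
    (hγ : γ ≠ 0) {S : Set (Fin n)} (hS : S ≠ Set.univ) {c α : (Fin n → ℂ) → Fin n → ℂ}
    {k0 : (Fin n → ℂ) → Mat n} {K : ℂ → (Fin n → ℂ) → Mat n}
    (hk00 : ∀ lam ∈ U, ∀ i j, j ∈ S → k0 lam i j = 0)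
    (hk0 : ∀ lam ∈ U, ∀ i j, j ∉ S → k0 lam i j = c lam j / (α lam j - lam i))
    (hK0 : ∀ lam ∈ U, ∀ u i j, j ∈ S → K u lam i j = 0)
    (hK : ∀ lam ∈ U, ∀ u i j, j ∉ S → K u lam i j = c lam j * (1 / (α lam j - lam i) - 1 / u))
    (hcne : ∀ lam ∈ U, ∀ j, j ∉ S → c lam j ≠ 0)
    (hne : ∀ lam ∈ U, ∀ i j, j ∉ S → α lam j - lam i ≠ 0)
    (hdiag : ∀ lam ∈ U, ∀ j, j ∉ S → α (shift γ j lam) j = α lam j + γ)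
    (hα : (∀ lam ∈ U, ∀ j l, j ∉ S → l ∉ S → j ≠ l →
        α lam l = α lam j ∧ α (shift γ j lam) l = α lam j + γ) ∨
      (∀ lam ∈ U, ∀ j l, j ∉ S → l ∉ S → j ≠ l →
        α lam l = α lam j - (lam j - lam l) ∧ α (shift γ j lam) l = α lam l))
    (hc : ∀ lam ∈ U, ∀ j l, j ∉ S → l ∉ S → j ≠ l →
      c lam l * (c (shift γ l lam) j * (α (shift γ l lam) j - lam l) /
        (α (shift γ l lam) j - lam l - γ)) * (lam j - lam l - γ) =
      c lam j * (c (shift γ j lam) l * (α (shift γ j lam) l - lam j) /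
        (α (shift γ j lam) l - lam j - γ)) * (lam j - lam l + γ)) :
    ExtendsUniquelyTo γ U S k0 K := by
  classical
  refine ⟨fun lam => Matrix.of fun _ j => if j ∈ S then 0 else -c lam j / γ, ?_, ?_,
    solvesSDRE_of_poles hU hγ hK0 hK hne hdiag hα hc, ?_⟩
  · intro lam hlam u hu
    ext i j
    simp only [firstOrder, Matrix.add_apply, Matrix.smul_apply, Matrix.of_apply, smul_eq_mul]
    by_cases hj : j ∈ S
    · rw [if_pos hj, hK0 lam hlam u i j hj, hk00 lam hlam i j hj]
      simp
    · have := hne lam hlam i j hj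
      rw [if_neg hj, hK lam hlam u i j hj, hk0 lam hlam i j hj]
      field_simp
      ring
  · intro lam hlam i j hj
    simpa [hj, hγ] using hcne lam hlam j hj
  · intro k1 hk1 lam hlam
    have hk0ne : ∀ j, j ∉ S → ∀ lam ∈ U, ∀ i, k0 lam i j ≠ 0 := fun j hj lam hlam i => by
      rw [hk0 lam hlam i j hj]
      exact div_ne_zero (hcne lam hlam j hj) (hne lam hlam i j hj)
    ext i j
    by_cases hj : j ∈ S
    · obtain ⟨j', hj'⟩ := (Set.ne_univ_iff_exists_notMem S).1 hS
      rw [hk1.column_eq_zero hU hγ (hk0ne j' hj') (fun lam hlam i => hk00 lam hlam i j hj) hlam]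
      simp [hj]
    · have h := hk1.coeff_of_pole hU hγ (j := j) (g := fun lam => α lam j - lam j)
        (R := fun lam => c lam j / (α lam j - lam j))
        (fun lam hlam => div_ne_zero (hcne lam hlam j hj) (hne lam hlam j j hj))
        (fun lam hlam k => by
          convert hne lam hlam k j hj using 1
          ring)
        (fun lam hlam => by
          rw [hdiag lam hlam j hj, shift_apply_self]
          ring)
        (fun lam hlam k => by
          have h1 := hne lam hlam k j hj
          have h2 := hne lam hlam j j hj
          rw [hk0 lam hlam k j hj,
            show α lam j - lam j - (lam k - lam j) = α lam j - lam k by ring]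
          field_simp) hn hlam i
      have h2 := hne lam hlam j j hj
      simp only [h, Matrix.of_apply, if_neg hj]
      rw [mul_div_cancel₀ _ h2]

lemma sum_shift (γ : ℂ) (lam : Fin n → ℂ) (j : Fin n) :
    ∑ a, shift γ j lam a = (∑ a, lam a) + γ := by
  simp [shift, Finset.sum_add_distrib]

/-- The shift of `λ_l` changes one factor of a product over the differences `λ_j - λ_a`. -/
lemma prod_shift_mul (γ : ℂ) (lam : Fin n → ℂ) (φ : ℂ → ℂ) {j l : Fin n} (h : j ≠ l) :
    (∏ a ∈ Finset.univ.erase j, φ (shift γ l lam j - shift γ l lam a)) * φ (lam j - lam l) =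
      (∏ a ∈ Finset.univ.erase j, φ (lam j - lam a)) * φ (lam j - lam l - γ) := by
  have hl : l ∈ Finset.univ.erase j := by simp [Ne.symm h]
  rw [← Finset.mul_prod_erase _ _ hl, ← Finset.mul_prod_erase _ _ hl]
  have : ∏ a ∈ (Finset.univ.erase j).erase l, φ (shift γ l lam j - shift γ l lam a) =
      ∏ a ∈ (Finset.univ.erase j).erase l, φ (lam j - lam a) := by
    refine Finset.prod_congr rfl fun a ha => ?_
    rw [shift_apply_of_ne γ lam h, shift_apply_of_ne γ lam (Finset.ne_of_mem_erase ha)]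
  rw [this, shift_apply_of_ne γ lam h, shift_apply_self, ← sub_sub]
  ring

lemma pref_ne_zero {γ : ℂ} {U : Set (Fin n → ℂ)} (hU : IsDomain γ U) (hγ : γ ≠ 0)
    {lam : Fin n → ℂ} (hlam : lam ∈ U) (j : Fin n) : pref γ lam j ≠ 0 :=
  Finset.prod_ne_zero_iff.2 fun _ ha =>
    div_ne_zero hγ (hU.sub_ne_zero hlam (Finset.ne_of_mem_erase ha).symm)

lemma pref_shift {γ : ℂ} {U : Set (Fin n → ℂ)} (hU : IsDomain γ U) (hγ : γ ≠ 0)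
    {lam : Fin n → ℂ} (hlam : lam ∈ U) {j l : Fin n} (h : j ≠ l) :
    pref γ (shift γ l lam) j * (lam j - lam l - γ) = pref γ lam j * (lam j - lam l) := by
  have h1 := hU.sub_ne_zero hlam h
  have h2 := hU.sub_sub_ne_zero hγ hlam j l
  have h3 := prod_shift_mul γ lam (fun s => γ / s) h
  rw [← pref, ← pref] at h3
  field_simp at h3
  linear_combination h3

lemma prefII_ne_zero {γ f : ℂ} {U : Set (Fin n → ℂ)} (hU : IsDomain γ U)
    {lam : Fin n → ℂ} (hlam : lam ∈ U) (hf : ∀ i j, f - (lam i - lam j) ≠ 0) (j : Fin n) :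
    prefII f lam j ≠ 0 := by
  refine Finset.prod_ne_zero_iff.2 fun a ha => ?_
  have h1 := hU.sub_ne_zero hlam (Finset.ne_of_mem_erase ha).symm
  have h2 := hf a j
  rw [one_add_div h1]
  exact div_ne_zero (by convert h2 using 1; ring) h1

lemma prefII_shift {γ f : ℂ} {U : Set (Fin n → ℂ)} (hU : IsDomain γ U) (hγ : γ ≠ 0)
    {lam : Fin n → ℂ} (hlam : lam ∈ U) {j l : Fin n} (h : j ≠ l) :
    prefII f (shift γ l lam) j * (lam j - lam l - γ) * (lam j - lam l + f) =
      prefII f lam j * (lam j - lam l) * (lam j - lam l - γ + f) := by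
  have h1 := hU.sub_ne_zero hlam h
  have h2 := hU.sub_sub_ne_zero hγ hlam j l
  have h3 := prod_shift_mul γ lam (fun s => 1 + f / s) h
  rw [← prefII, ← prefII] at h3
  field_simp at h3
  linear_combination h3

lemma extendsUniquelyTo_Ib (hn : 2 ≤ n) {γ : ℂ} {U : Set (Fin n → ℂ)} (hU : IsDomain γ U)
    (hγ : γ ≠ 0) {S : Set (Fin n)} (hS : S ≠ Set.univ) {f : (Fin n → ℂ) → ℂ}
    (hf : PeriodicOff γ U S f) (hne : ∀ lam ∈ U, ∀ i, f lam + Lam lam i ≠ 0) :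
    ExtendsUniquelyTo γ U S (fun lam => zeroCols S (constIb γ f lam))
      (fun u lam => zeroCols S (solIb γ f u lam)) := by
  have hα : ∀ lam : Fin n → ℂ, ∀ i, f lam + ∑ a, lam a - lam i = f lam + Lam lam i :=
    fun lam i => by rw [Lam]; ring
  refine extendsUniquelyTo_of_poles hn hU hγ hS
    (c := fun lam j => (f lam + Lam lam j) * pref γ lam j)
    (α := fun lam _ => f lam + ∑ a, lam a) ?_ ?_ ?_ ?_ ?_ ?_ ?_ (Or.inl ?_) ?_
  · intro lam _ i j hj
    simp [zeroCols, hj]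
  · intro lam hlam i j hj
    simp only [zeroCols, Matrix.of_apply, if_neg hj, constIb, hα]
    ring
  · intro lam _ u i j hj
    simp [zeroCols, hj]
  · intro lam hlam u i j hj
    simp only [zeroCols, Matrix.of_apply, if_neg hj, solIb, hα]
    ring
  · intro lam hlam j hj
    exact mul_ne_zero (hne lam hlam j) (pref_ne_zero hU hγ hlam j)
  · intro lam hlam i j hj
    rw [hα]
    exact hne lam hlam i
  · intro lam hlam j hj
    rw [hf lam hlam j hj, sum_shift]
    ring
  · intro lam hlam j l hj hl hjl
    rw [hf lam hlam j hj, sum_shift]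
    exact ⟨rfl, by ring⟩
  · intro lam hlam j l hj hl hjl
    have h1 := pref_shift hU hγ hlam hjl
    have h2 := pref_shift hU hγ hlam (Ne.symm hjl)
    have n1 := hne lam hlam j
    have n2 := hne lam hlam l
    simp only [hf lam hlam j hj, hf lam hlam l hl, sum_shift, Lam, shift_apply_of_ne γ lam hjl,
      shift_apply_of_ne γ lam (Ne.symm hjl)] at n1 n2 ⊢
    set P := pref γ (shift γ l lam) j
    set P' := pref γ (shift γ j lam) l
    set s := ∑ a, lam a
    rw [show f lam + (s + γ) - lam l - γ = f lam + (s - lam l) by ring,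
      show f lam + (s + γ) - lam j - γ = f lam + (s - lam j) by ring]
    field_simp
    linear_combination (f lam + (s + γ - lam j)) * (f lam + (s + γ - lam l)) *
      (pref γ lam l * h1 + pref γ lam j * h2)

lemma extendsUniquelyTo_IIb (hn : 2 ≤ n) {γ : ℂ} {U : Set (Fin n → ℂ)} (hU : IsDomain γ U)
    (hγ : γ ≠ 0) {S : Set (Fin n)} (hS : S ≠ Set.univ) {f : (Fin n → ℂ) → ℂ}
    (hf : PeriodicOff γ U S f) (hne : ∀ lam ∈ U, ∀ i j, f lam - (lam i - lam j) ≠ 0) :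
    ExtendsUniquelyTo γ U S (fun lam => zeroCols S (constIIb f lam))
      (fun u lam => zeroCols S (solIIb f u lam)) := by
  have hα : ∀ lam : Fin n → ℂ, ∀ i j, f lam + lam j - lam i = f lam - (lam i - lam j) :=
    fun lam i j => by ring
  refine extendsUniquelyTo_of_poles hn hU hγ hS
    (c := fun lam j => f lam * prefII (f lam) lam j)
    (α := fun lam j => f lam + lam j) ?_ ?_ ?_ ?_ ?_ ?_ ?_ (Or.inr ?_) ?_
  · intro lam _ i j hj
    simp [zeroCols, hj]
  · intro lam hlam i j hj
    simp only [zeroCols, Matrix.of_apply, if_neg hj, constIIb, hα]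
    ring
  · intro lam _ u i j hj
    simp [zeroCols, hj]
  · intro lam hlam u i j hj
    simp only [zeroCols, Matrix.of_apply, if_neg hj, solIIb, hα]
    ring
  · intro lam hlam j hj
    exact mul_ne_zero (by simpa using hne lam hlam j j) (prefII_ne_zero hU hlam (hne lam hlam) j)
  · intro lam hlam i j hj
    rw [hα]
    exact hne lam hlam i j
  · intro lam hlam j hj
    rw [hf lam hlam j hj, shift_apply_self]
    ring
  · intro lam hlam j l hj hl hjl
    rw [hf lam hlam j hj, shift_apply_of_ne γ lam (Ne.symm hjl)]
    exact ⟨by ring, rfl⟩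
  · intro lam hlam j l hj hl hjl
    have h1 := prefII_shift (f := f lam) hU hγ hlam hjl
    have h2 := prefII_shift (f := f lam) hU hγ hlam (Ne.symm hjl)
    have n1 := hne _ (hU.shift_mem lam hlam l) l j
    have n2 := hne _ (hU.shift_mem lam hlam j) j l
    simp only [hf lam hlam j hj, hf lam hlam l hl, shift_apply_self, shift_apply_of_ne γ lam hjl,
      shift_apply_of_ne γ lam (Ne.symm hjl)] at n1 n2 ⊢
    have n1' : f lam + lam j - lam l - γ ≠ 0 := by convert n1 using 1; ring
    have n2' : f lam + lam l - lam j - γ ≠ 0 := by convert n2 using 1; ring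
    set P := prefII (f lam) (shift γ l lam) j
    set P' := prefII (f lam) (shift γ j lam) l
    have hL : P * (f lam + lam j - lam l) / (f lam + lam j - lam l - γ) * (lam j - lam l - γ) =
        prefII (f lam) lam j * (lam j - lam l) := by
      rw [div_mul_eq_mul_div, div_eq_iff n1']
      linear_combination h1
    have hR : P' * (f lam + lam l - lam j) / (f lam + lam l - lam j - γ) * (lam l - lam j - γ) =
        prefII (f lam) lam l * (lam l - lam j) := by
      rw [div_mul_eq_mul_div, div_eq_iff n2']
      linear_combination h2
    linear_combination f lam ^ 2 * (prefII (f lam) lam l * hL + prefII (f lam) lam j * hR)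

/-- Column `j` is affine in `λ_k - λ_j` with `g = f + λ_j`. -/
lemma not_extends_Ia (hn : 3 ≤ n) {γ : ℂ} {U : Set (Fin n → ℂ)} (hU : IsDomain γ U)
    (hγ : γ ≠ 0) {S : Set (Fin n)} (hS : S ≠ Set.univ) {f : (Fin n → ℂ) → ℂ}
    (hf : PeriodicOff γ U S f) (hne : ∀ lam ∈ U, ∀ i, f lam + lam i ≠ 0) :
    ¬ Extends γ U (fun lam => zeroCols S (constIa γ f lam)) := by
  rintro ⟨k1, h⟩
  obtain ⟨j, hj⟩ := (Set.ne_univ_iff_exists_notMem S).1 hS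
  refine h.false_of_affine hU hγ (j := j) (g := fun lam => f lam + lam j)
    (R := fun lam => pref γ lam j) (fun lam hlam => pref_ne_zero hU hγ hlam j)
    (fun lam hlam => hne lam hlam j) ?_ ?_ ?_ hn
  · intro lam hlam k
    convert hne lam hlam k using 1
    ring
  · intro lam hlam
    rw [hf lam hlam j hj, shift_apply_self]
    ring
  · intro lam hlam k
    have := hne lam hlam j
    simp only [zeroCols, constIa, Matrix.of_apply, if_neg hj]
    field_simp
    ring

/-- Column `j` is affine in `λ_k - λ_j` with `g = f - Λ_{jj}`, which moves by `2γ - γ` when `λ_j` is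
shifted. -/
lemma not_extends_IIa (hn : 3 ≤ n) {γ : ℂ} {U : Set (Fin n → ℂ)} (hU : IsDomain γ U)
    (hγ : γ ≠ 0) {S : Set (Fin n)} (hS : S ≠ Set.univ) {f : (Fin n → ℂ) → ℂ}
    (hf : PeriodicOff γ U S f) (hne : ∀ lam ∈ U, ∀ i j, f lam - Lam2 lam i j ≠ 0) :
    ¬ Extends γ U (fun lam => zeroCols S (constIIa γ f lam)) := by
  rintro ⟨k1, h⟩
  obtain ⟨j, hj⟩ := (Set.ne_univ_iff_exists_notMem S).1 hS
  have hLam : ∀ (lam : Fin n → ℂ) k,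
      f lam - Lam2 lam j j + (lam k - lam j) = f lam - Lam2 lam k j := fun lam k => by
    simp only [Lam2]; ring
  refine h.false_of_affine hU hγ (j := j) (g := fun lam => f lam - Lam2 lam j j)
    (R := fun lam => (f lam - Lam2 lam j j) * pref γ lam j)
    (fun lam hlam => mul_ne_zero (hne lam hlam j j) (pref_ne_zero hU hγ hlam j))
    (fun lam hlam => hne lam hlam j j) ?_ ?_ ?_ hn
  · intro lam hlam k
    rw [hLam]
    exact hne lam hlam k j
  · intro lam hlam
    simp only [hf lam hlam j hj, Lam2, shift_apply_self, sum_shift]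
    ring
  · intro lam hlam k
    have := hne lam hlam j j
    simp only [zeroCols, constIIa, Matrix.of_apply, if_neg hj]
    rw [one_add_div this, hLam, ← mul_assoc, div_mul_cancel₀ _ this]

lemma zeroCols_empty (M : Mat n) : zeroCols ∅ M = M := by
  ext i j
  simp [zeroCols]

/-! ### The diagonal solution -/

lemma entryEq_one {γ : ℂ} {U : Set (Fin n → ℂ)} (hU : IsDomain γ U) (hγ : γ ≠ 0)
    {lam : Fin n → ℂ} (hlam : lam ∈ U) {u v : ℂ} (hv : v ≠ 0) (huv : u ≠ v)
    (hu' : u + γ ≠ 0) (hv' : v + γ ≠ 0) (i k j l : Fin n) :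
    EntryEq γ (fun _ _ => (1 : Mat n)) lam u v i k j l := by
  have huv' : u - v ≠ 0 := sub_ne_zero.2 huv
  have hx : ∀ i j, i ≠ j → lam i - lam j ≠ 0 := fun i j h => hU.sub_ne_zero hlam h
  have hy : ∀ i j, lam i - lam j - γ ≠ 0 := fun i j => hU.sub_sub_ne_zero hγ hlam i j
  have hxs : ∀ i j, x γ lam j i = -x γ lam i j := fun i j => by
    rw [x, x, ← neg_sub (lam i), div_neg]
  unfold EntryEq dressed
  have hx0 : ∀ i, x γ lam i i = 0 := fun i => by simp [x]
  rcases eq_or_ne j l with rfl | hjl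
  · rcases eq_or_ne i j with rfl | hij
    · rcases eq_or_ne k i with rfl | hki
      · simp [x, y]
        field_simp
        ring
      · have h1 := hx k i hki
        have h2 := hy k i
        simp [hki, hx0, hxs k i]
        rw [x, y]
        field_simp
        ring
    · rcases eq_or_ne k j with rfl | hkj
      · have h1 := hx i k hij
        have h2 := hy i k
        simp [hij, hx0]
        rw [x, y]
        field_simp
        ring
      · simp [hij, hkj]
  · have h1 := hx j l hjl
    have h2 := hy j l
    have h3 := hy l j
    have h3' : -(lam j - lam l) - γ ≠ 0 := by rwa [neg_sub]
    have e : y γ lam l j = γ / (-(lam j - lam l) - γ) := by rw [y, neg_sub]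
    have hlj := Ne.symm hjl
    rcases eq_or_ne k l with rfl | hkl
    · rcases eq_or_ne i j with rfl | hij
      · simp [hjl, hlj]
        rw [e, x, y]
        field_simp
        ring
      · simp [hij, hlj, hjl]
    · rcases eq_or_ne k j with rfl | hkj
      · rcases eq_or_ne i l with rfl | hil
        · simp [hjl, hlj, hxs k i]
          rw [e, x]
          field_simp
          ring
        · simp [hjl, hil]
      · rcases eq_or_ne i j with rfl | hij
        · simp [hjl, hkl, hkj]
        · simp [hij, hkl, hkj]

theorem solvesSDRE_diagonal {γ : ℂ} {U : Set (Fin n → ℂ)} (hU : IsDomain γ U) (hγ : γ ≠ 0)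
    {f : (Fin n → ℂ) → ℂ} (hf : PeriodicOff γ U ∅ f) :
    SolvesSDRE γ U (fun u lam => (1 + f lam / u) • (1 : Mat n)) := by
  rw [solvesSDRE_iff_entryEq]
  intro lam hlam u v hu hv huv hu' hv' i k j l
  have hd : ∀ w j k l, dressed γ w (fun lam => (1 + f lam / w) • (1 : Mat n)) lam j k l =
      (1 + f lam / w) * dressed γ w (fun _ => (1 : Mat n)) lam j k l := by
    intro w j k l
    simp only [dressed, hf lam hlam j (Set.notMem_empty j), Matrix.smul_apply, smul_eq_mul]
    ring
  have h := entryEq_one hU hγ hlam hv huv hu' hv' i k j l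
  unfold EntryEq at h ⊢
  simp only [hd, Matrix.smul_apply, smul_eq_mul]
  linear_combination (1 + f lam / u) * (1 + f lam / v) * h

end ACF

theorem mainTheorem1 (n : ℕ) (hn : 2 ≤ n) (γ : ℂ) (hγ : γ ≠ 0)
    (U : Set (Fin n → ℂ)) (hU : ACF.IsDomain γ U) :
    -- families Ia and IIa have no first-order extension (n ≥ 3)
    (3 ≤ n → ∀ f : (Fin n → ℂ) → ℂ, ACF.PeriodicOff γ U ∅ f →
      (∀ lam ∈ U, ∀ i, f lam + lam i ≠ 0) →
      ¬ ACF.Extends γ U (ACF.constIa γ f)) ∧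
    (3 ≤ n → ∀ f : (Fin n → ℂ) → ℂ, ACF.PeriodicOff γ U ∅ f →
      (∀ lam ∈ U, ∀ i j, f lam - ACF.Lam2 lam i j ≠ 0) →
      ¬ ACF.Extends γ U (ACF.constIIa γ f)) ∧
    -- families Ib and IIb extend uniquely, to the explicit matrices
    (∀ f : (Fin n → ℂ) → ℂ, ACF.PeriodicOff γ U ∅ f →
      (∀ lam ∈ U, ∀ i, f lam + ACF.Lam lam i ≠ 0) →
      ACF.ExtendsUniquelyTo γ U ∅ (ACF.constIb γ f) (ACF.solIb γ f)) ∧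
    (∀ f : (Fin n → ℂ) → ℂ, ACF.PeriodicOff γ U ∅ f →
      (∀ lam ∈ U, ∀ i j, f lam - (lam i - lam j) ≠ 0) →
      ACF.ExtendsUniquelyTo γ U ∅ (ACF.constIIb f) (ACF.solIIb f)) ∧
    -- a zero column of k⁽⁰⁾ forces the same column of k⁽¹⁾ to be zero
    (∀ (S : Set (Fin n)) (k0 k1 : (Fin n → ℂ) → ACF.Mat n), S ≠ Set.univ →
      (∀ lam ∈ U, ∀ i, ∀ j ∈ S, k0 lam i j = 0) →
      (∀ lam ∈ U, ∀ i, ∀ j, j ∉ S → k0 lam i j ≠ 0) →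
      ACF.SolvesSDRE γ U (ACF.firstOrder γ k0 k1) →
      ∀ lam ∈ U, ∀ i, ∀ j ∈ S, k1 lam i j = 0) ∧
    -- the same results for the families with the columns in S set to zero
    (∀ S : Set (Fin n), S ≠ Set.univ → ∀ f : (Fin n → ℂ) → ℂ, ACF.PeriodicOff γ U S f →
      (3 ≤ n → (∀ lam ∈ U, ∀ i, f lam + lam i ≠ 0) →
        ¬ ACF.Extends γ U (fun lam => ACF.zeroCols S (ACF.constIa γ f lam))) ∧
      (3 ≤ n → (∀ lam ∈ U, ∀ i j, f lam - ACF.Lam2 lam i j ≠ 0) →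
        ¬ ACF.Extends γ U (fun lam => ACF.zeroCols S (ACF.constIIa γ f lam))) ∧
      ((∀ lam ∈ U, ∀ i, f lam + ACF.Lam lam i ≠ 0) →
        ACF.ExtendsUniquelyTo γ U S (fun lam => ACF.zeroCols S (ACF.constIb γ f lam))
          (fun u lam => ACF.zeroCols S (ACF.solIb γ f u lam))) ∧
      ((∀ lam ∈ U, ∀ i j, f lam - (lam i - lam j) ≠ 0) →
        ACF.ExtendsUniquelyTo γ U S (fun lam => ACF.zeroCols S (ACF.constIIb f lam))
          (fun u lam => ACF.zeroCols S (ACF.solIIb f u lam)))) ∧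
    -- the diagonal solution 1 · (1 + f'/u)
    (∀ f' : (Fin n → ℂ) → ℂ, ACF.PeriodicOff γ U ∅ f' →
      ACF.SolvesSDRE γ U (fun u lam => (1 + f' lam / u) • (1 : ACF.Mat n))) := by
  have hS : (∅ : Set (Fin n)) ≠ Set.univ := fun h =>
    Set.notMem_empty (⟨0, by omega⟩ : Fin n) (h ▸ Set.mem_univ _)
  refine ⟨fun h3 f hf hne => ?_, fun h3 f hf hne => ?_, fun f hf hne => ?_, fun f hf hne => ?_,
    fun S k0 k1 hS' h0 hne h lam hlam i l hl => ?_,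
    fun S hS' f hf => ⟨fun h3 hne => ACF.not_extends_Ia h3 hU hγ hS' hf hne,
      fun h3 hne => ACF.not_extends_IIa h3 hU hγ hS' hf hne,
      fun hne => ACF.extendsUniquelyTo_Ib hn hU hγ hS' hf hne,
      fun hne => ACF.extendsUniquelyTo_IIb hn hU hγ hS' hf hne⟩,
    fun f' hf => ACF.solvesSDRE_diagonal hU hγ hf⟩
  · simpa only [ACF.zeroCols_empty] using ACF.not_extends_Ia h3 hU hγ hS hf hne
  · simpa only [ACF.zeroCols_empty] using ACF.not_extends_IIa h3 hU hγ hS hf hne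
  · simpa only [ACF.zeroCols_empty] using ACF.extendsUniquelyTo_Ib hn hU hγ hS hf hne
  · simpa only [ACF.zeroCols_empty] using ACF.extendsUniquelyTo_IIb hn hU hγ hS hf hne
  · obtain ⟨j, hj⟩ := (Set.ne_univ_iff_exists_notMem S).1 hS'
    exact h.column_eq_zero hU hγ (fun lam hlam i => hne lam hlam i j hj)
      (fun lam hlam i => h0 lam hlam i l hl) hlam i
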